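/- Let $\Lambda$ be an infinite preordered set (proset). Assume that $\Lambda$ is locally finite (every interval $[s_1,s_2]=\{s: s_1\preceq s\preceq s_2\}$ is finite) and irreducible, i.e. $\Lambda$ is not the disjoint union of two non-empty subsets $A,B$ such that every $a\in A$ and $b\in B$ are independent (not joined by a finite chain of elements of $\Lambda$ in which consecutive elements are comparable). Let $F$ be a finite field with the discrete topology. For a finite set $S\subset\Lambda$ let $\Lambda+S$ be the set $\Lambda$ with the smallest preorder $\preceq_+$ that contains $\preceq$ and makes all elements of $S$ equivalent: $a\preceq_+ b$ iff $a\preceq b$ or there are $t,q\in S$ with $a\preceq t$ and $q\preceq b$. Let $\mathrm{GL}_{\Lambda+S}(F)$ be the group of units of the incidence ring of $\Lambda+S$ over $F$, that is, of the ring of matrices $(a_{s,t})\in F^{\Lambda\times\Lambda}$ with $a_{s,t}=0$ unless $s\preceq_+ t$, with the multiplication $(ab)_{s,t}=\sum_{u\in[s,t]_{\preceq_+}}a_{s,u}b_{u,t}$; give it the subspace topology from the product topology on $F^{\Lambda\times\Lambda}$. Let $$\mathrm{aGL}_\Lambda(F)=\bigcup_{S\subset\Lambda\ \text{finite}}\mathrm{GL}_{\Lambda+S}(F)$$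 with the final (direct limit) topology for the inclusions of the $\mathrm{GL}_{\Lambda+S}(F)$, and let $\mathrm{aPGL}_\Lambda(F)=\mathrm{aGL}_\Lambda(F)/Z(\mathrm{aGL}_\Lambda(F))$ with the quotient topology. Then: 1. $\mathrm{aPGL}_\Lambda(F)$ is topologically simple: it is non-trivial and its only closed normal subgroups are the trivial subgroup and the whole group. 2. If moreover $\Lambda$ is countable, then $\mathrm{aPGL}_\Lambda(F)$ is a Hausdorff, totally disconnected topological group; it is locally elliptic, i.e. every compact subset is contained in a compact subgroup; and it is the union of an increasing sequence of subgroups each of which is, in the subspace topology, a second-countable profinite group. -/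

import Mathlib

/-! ### Preordered sets: neighbourhoods, independence, irreducibility -/

section Proset

variable {Λ : Type*} [Preorder Λ]

/-- The neighbourhoods `N_n(s)`: `N_0(s) = [s, s]`, `N_1(s)` is the set of elements comparable
with `s`, and `N_{n+1}(s)` is the union of the sets `N_1(t)` for `t ∈ N_n(s)` when `n ≥ 1`. -/
def nbhdSet (s : Λ) : ℕ → Set Λ
  | 0 => Set.Icc s s
  | 1 => {t | t ≤ s ∨ s ≤ t}
  | n + 2 => {u | ∃ t ∈ nbhdSet s (n + 1), u ≤ t ∨ t ≤ u}

/-- The full collection of neighbours of `s`. -/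
def fullNbhd (s : Λ) : Set Λ := ⋃ n : ℕ, nbhdSet s n

/-- `s` and `t` are independent: `s` is not in the full collection of neighbours of `t`. -/
def Independent (s t : Λ) : Prop := s ∉ fullNbhd t

variable (Λ) in
/-- A proset is irreducible if it is not the disjoint union of two non-empty subsets such that
every element of one is independent from every element of the other. -/
def IsIrreducibleProset : Prop :=
  ¬ ∃ A B : Set Λ, A.Nonempty ∧ B.Nonempty ∧ A ∪ B = Set.univ ∧ Disjoint A B ∧
    ∀ a ∈ A, ∀ b ∈ B, Independent a b

end Proset

/-! ### The proset `Λ + S` -/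

/-- The set `Λ`, to be equipped with the order of `Λ + S`. -/
def PlusOrder (Λ : Type*) (_S : Finset Λ) : Type _ := Λ

section PlusOrder

variable {Λ : Type*} [Preorder Λ] {S : Finset Λ}

/-- The order of `Λ + S`: the smallest preorder that contains the order of `Λ` and makes all
elements of `S` equivalent. -/
instance : Preorder (PlusOrder Λ S) where
  le s₁ s₂ := (show Λ from s₁) ≤ (show Λ from s₂) ∨
    ∃ t ∈ S, ∃ q ∈ S, (show Λ from s₁) ≤ t ∧ q ≤ (show Λ from s₂)
  le_refl s := Or.inl (le_refl (show Λ from s))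
  le_trans a b c hab hbc := by
    rcases hab with hab | ⟨t, ht, q, hq, h1, h2⟩
    · rcases hbc with hbc | ⟨t', ht', q', hq', h1', h2'⟩
      · exact Or.inl (le_trans hab hbc)
      · exact Or.inr ⟨t', ht', q', hq', le_trans hab h1', h2'⟩
    · rcases hbc with hbc | ⟨t', ht', q', hq', h1', h2'⟩
      · exact Or.inr ⟨t, ht, q, hq, h1, le_trans h2 hbc⟩
      · exact Or.inr ⟨t, ht, q', hq', h1, h2'⟩

theorem plusOrder_le_iff (a b : Λ) :
    (show PlusOrder Λ S from a) ≤ (show PlusOrder Λ S from b) ↔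
      a ≤ b ∨ ∃ t ∈ S, ∃ q ∈ S, a ≤ t ∧ q ≤ b := Iff.rfl

theorem plusOrder_mono {S S' : Finset Λ} (h : S ⊆ S') (a b : Λ)
    (hab : (show PlusOrder Λ S from a) ≤ (show PlusOrder Λ S from b)) :
    (show PlusOrder Λ S' from a) ≤ (show PlusOrder Λ S' from b) := by
  rcases hab with hab | ⟨t, ht, q, hq, h1, h2⟩
  · exact Or.inl hab
  · exact Or.inr ⟨t, h ht, q, h hq, h1, h2⟩

variable [LocallyFiniteOrder Λ]

theorem plusOrder_finite_Icc (a b : PlusOrder Λ S) : (Set.Icc a b).Finite := by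
  have key : (Set.Icc (show Λ from a) (show Λ from b) ∪
      (⋃ t ∈ S, Set.Icc (show Λ from a) t) ∪ (⋃ q ∈ S, Set.Icc q (show Λ from b)) ∪
      (⋃ q ∈ S, ⋃ t ∈ S, Set.Icc q t)).Finite := by
    refine ((((Set.finite_Icc _ _).union ?_).union ?_).union ?_)
    · exact S.finite_toSet.biUnion fun t _ => Set.finite_Icc _ _
    · exact S.finite_toSet.biUnion fun t _ => Set.finite_Icc _ _
    · exact S.finite_toSet.biUnion fun q _ => S.finite_toSet.biUnion fun t _ => Set.finite_Icc _ _
  refine Set.Finite.subset key ?_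
  rintro x ⟨hax, hxb⟩
  simp only [Set.mem_union, Set.mem_iUnion, exists_prop]
  rcases hax with hax | ⟨t, ht, q, hq, h1, h2⟩
  · rcases hxb with hxb | ⟨t', ht', q', hq', h1', h2'⟩
    · exact Or.inl (Or.inl (Or.inl ⟨hax, hxb⟩))
    · exact Or.inl (Or.inl (Or.inr ⟨t', ht', hax, h1'⟩))
  · rcases hxb with hxb | ⟨t', ht', q', hq', h1', h2'⟩
    · exact Or.inl (Or.inr ⟨q, hq, h2, hxb⟩)
    · exact Or.inr ⟨q, hq, t', ht', h2, h1'⟩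

noncomputable instance : LocallyFiniteOrder (PlusOrder Λ S) :=
  LocallyFiniteOrder.ofFiniteIcc plusOrder_finite_Icc

noncomputable instance instDecidableEqPlusOrder : DecidableEq (PlusOrder Λ S) :=
  Classical.decEq _

end PlusOrder

/-! ### The groups `GL_{Λ+S}(P)` and `aGL_Λ(P)` -/

section Groups

variable (Λ : Type*) [Preorder Λ] [LocallyFiniteOrder Λ] (P : Type*) [CommRing P]

/-- `GL_{Λ+S}(P)`: the group of units of the incidence ring of `Λ + S` over `P`. -/
abbrev GLPlus (S : Finset Λ) : Type _ := (IncidenceAlgebra P (PlusOrder Λ S))ˣ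

variable {Λ P}

/-- An element of `GL_{Λ+S}(P)` as an infinite matrix indexed by `Λ × Λ`. -/
def GLPlus.toMatrix {S : Finset Λ} (u : GLPlus Λ P S) : Matrix Λ Λ P :=
  fun s t => (u : IncidenceAlgebra P (PlusOrder Λ S)) (show PlusOrder Λ S from s)
    (show PlusOrder Λ S from t)

variable (Λ P) in
/-- The underlying type of `aGL_Λ(P)`: the matrices which belong to `GL_{Λ+S}(P)` for some finite
subset `S` of `Λ`. -/
def AlmostGL : Type _ :=
  {A : Matrix Λ Λ P // ∃ (S : Finset Λ) (u : GLPlus Λ P S), u.toMatrix = A}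

/-- The inclusion of `GL_{Λ+S}(P)` into `aGL_Λ(P)`. -/
def AlmostGL.ofGL {S : Finset Λ} (u : GLPlus Λ P S) : AlmostGL Λ P := ⟨u.toMatrix, S, u, rfl⟩

/-- The matrix product `(A * B)_{s,t} = ∑_u A_{s,u} B_{u,t}`. For matrices in an incidence ring,
all terms with `u` outside the interval `[s, t]` vanish, and this is the product of that ring
(see `GLPlus.toMatrix_mul`). -/
noncomputable def matProd (A B : Matrix Λ Λ P) : Matrix Λ Λ P :=
  fun s t => ∑ᶠ u, A s u * B u t

theorem GLPlus.toMatrix_mul {S : Finset Λ} (u v : GLPlus Λ P S) :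
    (u * v).toMatrix = matProd u.toMatrix v.toMatrix := by
  funext s t
  have h := finsum_eq_sum_of_support_subset
    (s := Finset.Icc (show PlusOrder Λ S from s) (show PlusOrder Λ S from t))
    (fun x : PlusOrder Λ S => (u : IncidenceAlgebra P (PlusOrder Λ S)) s x *
      (v : IncidenceAlgebra P (PlusOrder Λ S)) x t) (by
      intro x hx
      rw [Finset.coe_Icc]
      exact ⟨IncidenceAlgebra.le_of_ne_zero (left_ne_zero_of_mul hx),
        IncidenceAlgebra.le_of_ne_zero (right_ne_zero_of_mul hx)⟩)
  exact h.symm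

/-- The ring inclusion `M_{Λ+S}(P) → M_{Λ+S'}(P)` for `S ⊆ S'`, as a monoid homomorphism. -/
noncomputable def inclIncidence {S S' : Finset Λ} (h : S ⊆ S') :
    IncidenceAlgebra P (PlusOrder Λ S) →* IncidenceAlgebra P (PlusOrder Λ S') where
  toFun f := ⟨fun a b => f a b, fun a b hab =>
    IncidenceAlgebra.apply_eq_zero_of_not_le (fun h' => hab (plusOrder_mono h a b h')) f⟩
  map_one' := by
    ext a b _
    exact @if_congr _ _ _ (instDecidableEqPlusOrder (S := S) a b)
      (instDecidableEqPlusOrder (S := S') a b) _ _ _ _ Iff.rfl rfl rfl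
  map_mul' f g := by
    ext a b _
    refine Finset.sum_subset (fun x hx => ?_) (fun x _ hx => ?_)
    · have hx' := Finset.mem_Icc.1 hx
      exact (Finset.mem_Icc (α := PlusOrder Λ S')).2
        ⟨plusOrder_mono h _ _ hx'.1, plusOrder_mono h _ _ hx'.2⟩
    · by_contra h0
      exact hx (Finset.mem_Icc.2 ⟨IncidenceAlgebra.le_of_ne_zero (left_ne_zero_of_mul h0),
        IncidenceAlgebra.le_of_ne_zero (right_ne_zero_of_mul h0)⟩)

/-- The inclusion `GL_{Λ+S}(P) → GL_{Λ+S'}(P)` for `S ⊆ S'`. -/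
noncomputable def GLPlus.incl {S S' : Finset Λ} (h : S ⊆ S') : GLPlus Λ P S →* GLPlus Λ P S' :=
  Units.map (inclIncidence h)

theorem GLPlus.toMatrix_incl {S S' : Finset Λ} (h : S ⊆ S') (u : GLPlus Λ P S) :
    (GLPlus.incl h u).toMatrix = u.toMatrix := rfl

theorem GLPlus.toMatrix_one (S S' : Finset Λ) :
    (1 : GLPlus Λ P S).toMatrix = (1 : GLPlus Λ P S').toMatrix := by
  funext s t
  exact @if_congr _ _ _ (instDecidableEqPlusOrder (S := S) s t)
    (instDecidableEqPlusOrder (S := S') s t) _ _ _ _ Iff.rfl rfl rfl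

namespace AlmostGL

theorem exists_ofGL (A : AlmostGL Λ P) : ∃ (S : Finset Λ) (u : GLPlus Λ P S), ofGL u = A := by
  obtain ⟨A, S, u, h⟩ := A
  exact ⟨S, u, Subtype.ext h⟩

theorem ofGL_incl {S S' : Finset Λ} (h : S ⊆ S') (u : GLPlus Λ P S) :
    ofGL (GLPlus.incl h u) = ofGL u := rfl

theorem exists_ofGL_of_subset {S S' : Finset Λ} (h : S ⊆ S') (u : GLPlus Λ P S) :
    ∃ v : GLPlus Λ P S', ofGL v = ofGL u := ⟨GLPlus.incl h u, rfl⟩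

open Classical in
theorem exists_common₂ (A B : AlmostGL Λ P) :
    ∃ (S : Finset Λ) (u v : GLPlus Λ P S), ofGL u = A ∧ ofGL v = B := by
  obtain ⟨S, u, rfl⟩ := exists_ofGL A
  obtain ⟨T, v, rfl⟩ := exists_ofGL B
  exact ⟨S ∪ T, GLPlus.incl Finset.subset_union_left u, GLPlus.incl Finset.subset_union_right v,
    rfl, rfl⟩

open Classical in
theorem exists_common₃ (A B C : AlmostGL Λ P) :
    ∃ (S : Finset Λ) (u v w : GLPlus Λ P S), ofGL u = A ∧ ofGL v = B ∧ ofGL w = C := by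
  obtain ⟨S, u, v, rfl, rfl⟩ := exists_common₂ A B
  obtain ⟨T, w, rfl⟩ := exists_ofGL C
  exact ⟨S ∪ T, GLPlus.incl Finset.subset_union_left u, GLPlus.incl Finset.subset_union_left v,
    GLPlus.incl Finset.subset_union_right w, rfl, rfl, rfl⟩

noncomputable instance : Mul (AlmostGL Λ P) where
  mul A B := ⟨matProd A.1 B.1, by
    obtain ⟨S, u, v, rfl, rfl⟩ := exists_common₂ A B
    exact ⟨S, u * v, GLPlus.toMatrix_mul u v⟩⟩

noncomputable instance : One (AlmostGL Λ P) where
  one := ofGL (1 : GLPlus Λ P ∅)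

/-- The inverse of the infinite matrix `A`, computed in any `GL_{Λ+S}(P)` which contains `A`. -/
noncomputable instance : Inv (AlmostGL Λ P) where
  inv A := ofGL (exists_ofGL A).choose_spec.choose⁻¹

theorem ofGL_mul {S : Finset Λ} (u v : GLPlus Λ P S) : ofGL (u * v) = ofGL u * ofGL v :=
  Subtype.ext (GLPlus.toMatrix_mul u v)

theorem ofGL_one (S : Finset Λ) : ofGL (1 : GLPlus Λ P S) = 1 :=
  Subtype.ext (GLPlus.toMatrix_one S ∅)

noncomputable instance : Group (AlmostGL Λ P) :=
  Group.ofLeftAxioms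
    (by
      intro A B C
      obtain ⟨S, u, v, w, rfl, rfl, rfl⟩ := exists_common₃ A B C
      rw [← ofGL_mul, ← ofGL_mul, ← ofGL_mul, ← ofGL_mul, mul_assoc])
    (by
      intro A
      obtain ⟨S, u, rfl⟩ := exists_ofGL A
      rw [← ofGL_one S, ← ofGL_mul, one_mul])
    (by
      intro A
      have h : ofGL (exists_ofGL A).choose_spec.choose = A :=
        (exists_ofGL A).choose_spec.choose_spec
      calc A⁻¹ * A = ofGL (exists_ofGL A).choose_spec.choose⁻¹ *
            ofGL (exists_ofGL A).choose_spec.choose := by rw [h]; rfl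
        _ = 1 := by rw [← ofGL_mul, inv_mul_cancel, ofGL_one])

/-- The final (direct limit) topology on `aGL_Λ(P)` for the inclusions of the groups
`GL_{Λ+S}(P)`, `S ⊆ Λ` finite, each of which has the subspace topology of the product
topology on `P^{Λ × Λ}`. -/
instance [TopologicalSpace P] : TopologicalSpace (AlmostGL Λ P) :=
  ⨆ S : Finset Λ, TopologicalSpace.coinduced (fun u : GLPlus Λ P S => ofGL u)
    (TopologicalSpace.induced (fun u : GLPlus Λ P S => u.toMatrix) inferInstance)

end AlmostGL

variable (Λ P) in
/-- `aPGL_Λ(P)`: the quotient of `aGL_Λ(P)` by its center. For topological `P` it carries the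
quotient topology. -/
abbrev AlmostPGL : Type _ := AlmostGL Λ P ⧸ Subgroup.center (AlmostGL Λ P)

end Groups

/-! ### Properties of groups with a topology -/

section TopGroups

variable (G : Type*) [Group G] [TopologicalSpace G]

/-- `G` is non-trivial, and its only closed normal subgroups are the trivial one and `G`. -/
def IsTopologicallySimple : Prop :=
  Nontrivial G ∧ ∀ N : Subgroup G, N.Normal → IsClosed (N : Set G) → N = ⊥ ∨ N = ⊤

/-- Every compact subset of `G` is contained in a compact subgroup. -/
def IsLocallyElliptic : Prop :=
  ∀ K : Set G, IsCompact K → ∃ H : Subgroup G, K ⊆ H ∧ IsCompact (H : Set G)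

/-- `G` is a profinite group: a compact, Hausdorff, totally disconnected topological group. -/
structure IsProfiniteGroup : Prop where
  isTopologicalGroup : IsTopologicalGroup G
  compactSpace : CompactSpace G
  t2Space : T2Space G
  totallyDisconnectedSpace : TotallyDisconnectedSpace G

end TopGroups

/-!
Topological simplicity follows from the classical computation with commutators. Let `N` be a closed
normal subgroup of `aGL_Λ(F)` which is not central. Two commutators move a non-diagonal element of
`N` to a matrix `1 + x ρ` with a column `x` of finite support and a possibly infinite row `ρ`; here
`x` has to be annihilated by a row of the inverse of the given element, which is one linear
condition on the finitely supported columns. Two more commutators cut `ρ` down to one entry, so `N`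
contains a non-trivial elementary matrix (`exists_elemUnit_mem`, `AlmostGL.exists_elem_mem`).
Finitely many indices can always be made equivalent by enlarging `S`, and since `Λ` is infinite
there are always fresh indices, so commutators of elementary matrices give all elementary matrices
(`AlmostGL.elem_mem_of_elem_mem`). The determinant is no obstruction in the limit: `diag(c, c⁻¹)` is
a product of elementary matrices, and moving the entry `c⁻¹` off to infinity shows that the closed
subgroup `N` contains `diag(c, 1)` (`AlmostGL.diag_mulSingle_mem`). Hence `N` contains all finite
invertible matrices, and these are dense: the truncation of an element of `GL_{Λ+S}(F)` to a finite
order convex set of indices is again invertible (`AlmostGL.eq_top_of_elem_mem`).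

For the topological statements, the unit group of the compact ring of matrices over `Λ + S` is
profinite, and its topology is that of entrywise convergence
(`GLPlus.isClosedEmbedding_toMatrix`). If `Λ` is countable, `aGL_Λ(F)` is the limit of a sequence of
such groups. Inside a given neighbourhood of the identity one builds an increasing sequence of
compact subgroups, the `n`-th one being open in the `n`-th group of the sequence; their union is an
open subgroup (`AlmostGL.exists_subgroup_isOpen`). Since translations and inversion are continuous
by the universal property, `aGL_Λ(F)` is a nonarchimedean topological group, and so is its
quotient by the center, which is closed. Local ellipticity holds because a compact subset of
`aPGL_Λ(F)` lies in the image of one group of the sequence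
(`AlmostPGL.exists_subset_range_ofGLHom`).
-/

/-! ### Commutators with square-zero perturbations of the identity -/

section SquareZero

variable {R : Type*} [Ring R]

/-- The unit `1 + X`, with inverse `1 - X`, for an element `X` with `X * X = 0`. -/
def oneAddUnit (X : R) (hX : X * X = 0) : Rˣ where
  val := 1 + X
  inv := 1 - X
  val_inv := by simp [mul_sub, add_mul, hX]
  inv_val := by simp [mul_add, sub_mul, hX]

/-- The commutator of `1 + Y` and `1 + B` is `1 + Y * B` as soon as `B * Y = 0`. -/
theorem oneAddUnit_mul_mem {N : Subgroup Rˣ} [N.Normal] {Y B : R} {hY : Y * Y = 0}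
    {hB : B * B = 0} (hBY : B * Y = 0) (hYB : Y * B * (Y * B) = 0)
    (h : oneAddUnit Y hY ∈ N ∨ oneAddUnit B hB ∈ N) : oneAddUnit (Y * B) hYB ∈ N := by
  have key : oneAddUnit (Y * B) hYB =
      oneAddUnit Y hY * oneAddUnit B hB * (oneAddUnit Y hY)⁻¹ * (oneAddUnit B hB)⁻¹ := by
    ext
    change 1 + Y * B = (1 + Y) * (1 + B) * (1 - Y) * (1 - B)
    have e1 : (1 + Y) * (1 + B) * (1 - Y) =
        1 + B + Y * B - Y * Y - B * Y - Y * (B * Y) := by noncomm_ring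
    rw [e1, hY, hBY]
    have e2 : (1 + B + Y * B - 0 - 0 - Y * 0) * (1 - B) = 1 + Y * B - B * B - Y * (B * B) := by
      noncomm_ring
    rw [e2, hB]
    simp
  rw [key]
  rcases h with h | h
  · rw [mul_assoc (oneAddUnit Y hY * _), mul_assoc (oneAddUnit Y hY), ← mul_assoc (oneAddUnit B hB)]
    exact N.mul_mem h (Subgroup.Normal.conj_mem inferInstance _ (N.inv_mem h) _)
  · exact N.mul_mem (Subgroup.Normal.conj_mem inferInstance _ h _) (N.inv_mem h)

/-- If `g` lies in the normal subgroup `N` and `A` has square zero, then `N` contains the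
commutator `h` of `g` and `1 + A`; when `h * X = X`, the commutator of `h` and `1 + X` is
`1 - X * g * A * g⁻¹`. -/
theorem oneAddUnit_neg_mem {N : Subgroup Rˣ} [N.Normal] {g : Rˣ} (hg : g ∈ N) {A X : R}
    (hA : A * A = 0) (hX : X * X = 0) (hAX : A * X = 0) (hXA : X * A = 0)
    (hgX : A * (↑g⁻¹ * X) = 0)
    (hY : -(X * g * A * ↑g⁻¹) * -(X * g * A * ↑g⁻¹) = 0) :
    oneAddUnit (-(X * g * A * ↑g⁻¹)) hY ∈ N := by
  have hh : g * oneAddUnit A hA * g⁻¹ * (oneAddUnit A hA)⁻¹ ∈ N := by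
    rw [mul_assoc g, mul_assoc g]
    exact N.mul_mem hg (Subgroup.Normal.conj_mem inferInstance _ (N.inv_mem hg) _)
  set h := g * oneAddUnit A hA * g⁻¹ * (oneAddUnit A hA)⁻¹ with hdef
  have hhX : (h : R) * X = X := by
    have : (h : R) * X = ↑g * ((1 + A) * (↑g⁻¹ * ((1 - A) * X))) := by
      simp only [hdef, Units.val_mul, mul_assoc]; rfl
    rw [this, sub_mul, hAX, one_mul, sub_zero, add_mul, hgX, one_mul, add_zero,
      Units.mul_inv_cancel_left]
  have hXh : X * ((h⁻¹ : Rˣ) : R) = X - X * g * A * ↑g⁻¹ := by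
    have e : h⁻¹ = oneAddUnit A hA * g * (oneAddUnit A hA)⁻¹ * g⁻¹ := by
      rw [hdef]; group
    have : X * ((h⁻¹ : Rˣ) : R) = X * (1 + A) * (↑g * (1 - A) * ↑g⁻¹) := by
      rw [e]; simp only [Units.val_mul, mul_assoc]; rfl
    rw [this, mul_add, hXA, mul_one, add_zero, mul_sub, sub_mul, mul_one, Units.mul_inv, mul_sub,
      mul_one]
    simp only [mul_assoc]
  have key : oneAddUnit (-(X * g * A * ↑g⁻¹)) hY =
      h * (oneAddUnit X hX * h⁻¹ * (oneAddUnit X hX)⁻¹) := by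
    ext
    have : ((h * (oneAddUnit X hX * h⁻¹ * (oneAddUnit X hX)⁻¹) : Rˣ) : R) =
        (h * ↑h⁻¹ + h * X * ↑h⁻¹) * (1 - X) := by
      simp only [Units.val_mul]
      change (h : R) * ((1 + X) * ↑h⁻¹ * (1 - X)) = _
      noncomm_ring
    rw [this, Units.mul_inv, hhX, hXh]
    change 1 + -(X * g * A * ↑g⁻¹) = _
    have e : (1 + (X - X * g * A * ↑g⁻¹)) * (1 - X) =
        1 + -(X * g * A * ↑g⁻¹) - X * X + X * g * (A * (↑g⁻¹ * X)) := by noncomm_ring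
    rw [e, hX, hgX]
    simp
  rw [key]
  exact N.mul_mem hh (Subgroup.Normal.conj_mem inferInstance _ (N.inv_mem hh) _)

theorem oneAddUnit_congr {X Y : R} (h : X = Y) (hX : X * X = 0) (hY : Y * Y = 0) :
    oneAddUnit X hX = oneAddUnit Y hY := by
  subst h; rfl

end SquareZero

/-! ### Matrix units in incidence algebras -/

section MatrixUnits

variable {F α : Type*} [Field F] [Preorder α]

/-- The element of the incidence algebra with entry `c` at `(a, b)` and zero elsewhere, for
`a ≤ b`; it is zero if `a ≤ b` fails. -/
noncomputable def matUnit (a b : α) (c : F) : IncidenceAlgebra F α where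
  toFun x y := open Classical in if a ≤ b ∧ x = a ∧ y = b then c else 0
  eq_zero_of_not_le' _ _ h := if_neg fun ⟨h1, h2, h3⟩ => h (h2 ▸ h3 ▸ h1)

open Classical in
theorem matUnit_apply (a b : α) (c : F) (x y : α) :
    matUnit a b c x y = if a ≤ b ∧ x = a ∧ y = b then c else 0 := rfl

theorem matUnit_apply_self {a b : α} (h : a ≤ b) (c : F) : matUnit a b c a b = c := by
  simp [matUnit_apply, h]

theorem matUnit_zero (a b : α) : matUnit a b (0 : F) = 0 := by
  ext x y _
  simp [matUnit_apply]

theorem matUnit_neg (a b : α) (c : F) : -matUnit a b c = matUnit a b (-c) := by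
  ext x y _
  simp only [IncidenceAlgebra.neg_apply, matUnit_apply]
  split_ifs <;> simp

theorem matUnit_add (a b : α) (c d : F) : matUnit a b c + matUnit a b d = matUnit a b (c + d) := by
  ext x y _
  simp only [IncidenceAlgebra.add_apply, matUnit_apply]
  split_ifs <;> simp

variable [LocallyFiniteOrder α] [DecidableEq α]

theorem matUnit_mul_mul {a b c d : α} (hab : a ≤ b) (hcd : c ≤ d) (x y : F)
    (f : IncidenceAlgebra F α) :
    matUnit a b x * f * matUnit c d y = matUnit a d (x * f b c * y) := by
  ext s t hst
  by_cases hbc : b ≤ c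
  · have had : a ≤ d := hab.trans (hbc.trans hcd)
    by_cases hs : s = a
    · by_cases ht : t = d
      · subst hs ht
        rw [IncidenceAlgebra.mul_apply, Finset.sum_eq_single c]
        · rw [IncidenceAlgebra.mul_apply, Finset.sum_eq_single b]
          · simp [matUnit_apply, hab, hcd, had]
          · intro u _ hu
            simp [matUnit_apply, hu]
          · intro h
            exact absurd (Finset.mem_Icc.2 ⟨hab, hbc⟩) h
        · intro u _ hu
          simp [matUnit_apply, hu]
        · intro h
          exact absurd (Finset.mem_Icc.2 ⟨hab.trans hbc, hcd⟩) h
      · simp [matUnit_apply, ht]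
    · simp [matUnit_apply, hs]
  · rw [IncidenceAlgebra.apply_eq_zero_of_not_le hbc, mul_zero, zero_mul, matUnit_zero,
      IncidenceAlgebra.mul_apply]
    refine Finset.sum_eq_zero fun u _ => ?_
    rw [IncidenceAlgebra.mul_apply, Finset.sum_mul]
    refine Finset.sum_eq_zero fun v hv => ?_
    by_cases hv' : v = b
    · by_cases hu : u = c
      · subst hu hv'
        exact absurd (Finset.mem_Icc.1 hv).2 hbc
      · simp [matUnit_apply, hu]
    · simp [matUnit_apply, hv']

theorem matUnit_mul {a b d : α} (hab : a ≤ b) (hbd : b ≤ d) (x y : F) :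
    matUnit a b x * matUnit b d y = matUnit a d (x * y) := by
  simpa using matUnit_mul_mul hab hbd x y 1

theorem matUnit_mul_of_ne {b c : α} (h : b ≠ c) (a d : α) (x y : F) :
    matUnit a b x * matUnit c d y = 0 := by
  ext s t hst
  rw [IncidenceAlgebra.mul_apply]
  refine Finset.sum_eq_zero fun u _ => ?_
  by_cases hu : u = b
  · subst hu
    simp [matUnit_apply, h]
  · simp [matUnit_apply, hu]

/-- The elementary unit `1 + c E_{ab}` of the incidence algebra. -/
noncomputable def elemUnit {a b : α} (h : a ≠ b) (c : F) : (IncidenceAlgebra F α)ˣ :=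
  oneAddUnit (matUnit a b c) (matUnit_mul_of_ne h.symm _ _ _ _)

variable {N : Subgroup (IncidenceAlgebra F α)ˣ} [N.Normal]

/-- The commutator of `1 + x E_{ab}` and `1 + y E_{bc}` is `1 + x y E_{ac}`. -/
theorem elemUnit_comm_mem {a b c : α} (hab : a ≠ b) (hbc : b ≠ c) (hac : a ≠ c) (lab : a ≤ b)
    (lbc : b ≤ c) (x y : F) (h : elemUnit hab x ∈ N ∨ elemUnit hbc y ∈ N) :
    elemUnit hac (x * y) ∈ N := by
  have e := matUnit_mul lab lbc x y
  have := oneAddUnit_mul_mem (N := N) (matUnit_mul_of_ne hac.symm _ _ _ _)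
    (by rw [e]; exact matUnit_mul_of_ne hac.symm _ _ _ _) h
  rwa [oneAddUnit_congr e _ (matUnit_mul_of_ne hac.symm _ _ _ _)] at this

/-- A normal subgroup containing a unit with a nonzero off-diagonal entry contains a non-trivial
elementary unit, provided that there are enough pairwise equivalent indices. -/
theorem exists_elemUnit_mem {g : (IncidenceAlgebra F α)ˣ} (hg : g ∈ N) {E : Set α}
    (hE : ∀ a ∈ E, ∀ b ∈ E, a ≤ b) {i s u p q j m : α} (hi : i ∈ E) (hs : s ∈ E) (hu : u ∈ E)
    (hp : p ∈ E) (hq : q ∈ E) (hj : j ∈ E) (hm : m ∈ E) (his : i ≠ s) (hpi : p ≠ i) (hqi : q ≠ i)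
    (hpq : p ≠ q) (hju : j ≠ u) (hjp : j ≠ p) (hjq : j ≠ q) (hmj : m ≠ j) (hmp : m ≠ p) {β : F}
    (hβ : (↑g⁻¹ : IncidenceAlgebra F α) i p + β * (↑g⁻¹ : IncidenceAlgebra F α) i q = 0) :
    elemUnit hmj (-((g : IncidenceAlgebra F α) i s * (↑g⁻¹ : IncidenceAlgebra F α) i u)) ∈ N := by
  set A : IncidenceAlgebra F α := matUnit s i 1 with hA
  -- The relation `hβ` says that row `i` of `g⁻¹` annihilates the column of `X`.
  set X : IncidenceAlgebra F α := matUnit p i 1 + matUnit q i β with hX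
  have hAA : A * A = 0 := matUnit_mul_of_ne his _ _ _ _
  have hXX : X * X = 0 := by
    simp only [hX, mul_add, add_mul, matUnit_mul_of_ne hpi.symm, matUnit_mul_of_ne hqi.symm,
      add_zero]
  have hAX : A * X = 0 := by
    simp only [hX, hA, mul_add, matUnit_mul_of_ne hpi.symm, matUnit_mul_of_ne hqi.symm, add_zero]
  have hXA : X * A = 0 := by
    simp only [hX, hA, add_mul, matUnit_mul_of_ne his, add_zero]
  have hgX : A * (↑g⁻¹ * X) = 0 := by
    rw [← mul_assoc, hX, mul_add, hA, matUnit_mul_mul (hE _ hs _ hi) (hE _ hp _ hi),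
      matUnit_mul_mul (hE _ hs _ hi) (hE _ hq _ hi), matUnit_add]
    convert matUnit_zero (F := F) s i using 2
    rw [← hβ]; ring
  have hYY : -(X * g * A * ↑g⁻¹) * -(X * g * A * ↑g⁻¹) = 0 := by
    have : -(X * g * A * ↑g⁻¹) * -(X * g * A * ↑g⁻¹) =
        X * g * (A * (↑g⁻¹ * X)) * g * A * ↑g⁻¹ := by noncomm_ring
    rw [this, hgX]; simp
  have h1 := oneAddUnit_neg_mem hg hAA hXX hAX hXA hgX hYY
  have hBX : matUnit u j (1 : F) * X = 0 := by
    simp only [hX, mul_add, matUnit_mul_of_ne hjp, matUnit_mul_of_ne hjq, add_zero]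
  have hBY : matUnit u j (1 : F) * -(X * g * A * ↑g⁻¹) = 0 := by
    have : matUnit u j (1 : F) * -(X * g * A * ↑g⁻¹) =
        -((matUnit u j (1 : F) * X) * g * A * ↑g⁻¹) := by noncomm_ring
    rw [this, hBX]; simp
  have hBB : matUnit u j (1 : F) * matUnit u j (1 : F) = 0 := matUnit_mul_of_ne hju _ _ _ _
  set Y := -(X * g * A * ↑g⁻¹) with hY
  have h2 := oneAddUnit_mul_mem (hB := hBB) hBY
    (by rw [mul_assoc, ← mul_assoc _ Y, hBY]; simp) (Or.inl h1)
  have hCC : matUnit m p (1 : F) * matUnit m p (1 : F) = 0 := matUnit_mul_of_ne hmp.symm _ _ _ _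
  have hZC : Y * matUnit u j (1 : F) * matUnit m p (1 : F) = 0 := by
    rw [mul_assoc, matUnit_mul_of_ne hmj.symm, mul_zero]
  have e : matUnit m p (1 : F) * (Y * matUnit u j (1 : F)) =
      matUnit m j (-((g : IncidenceAlgebra F α) i s * (↑g⁻¹ : IncidenceAlgebra F α) i u)) := by
    have e1 : matUnit m p (1 : F) * X = matUnit m i 1 := by
      rw [hX, mul_add, matUnit_mul (hE _ hm _ hp) (hE _ hp _ hi), matUnit_mul_of_ne hpq, add_zero,
        mul_one]
    have e2 : matUnit m p (1 : F) * (Y * matUnit u j (1 : F)) =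
        -(matUnit m p (1 : F) * X * g * A * ↑g⁻¹ * matUnit u j (1 : F)) := by
      rw [hY]; noncomm_ring
    rw [e2, e1, hA, matUnit_mul_mul (hE _ hm _ hi) (hE _ hs _ hi),
      matUnit_mul_mul (hE _ hm _ hi) (hE _ hu _ hj), matUnit_neg]
    congr 1; ring
  have h3 := oneAddUnit_mul_mem (hY := hCC) hZC
    (by rw [e]; exact matUnit_mul_of_ne hmj.symm _ _ _ _) (Or.inr h2)
  rwa [oneAddUnit_congr e _ (matUnit_mul_of_ne hmj.symm _ _ _ _)] at h3

end MatrixUnits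

/-! ### Elementary matrices in normal subgroups of the almost general linear group -/

section Elementary

variable {Λ : Type*} [Preorder Λ] [LocallyFiniteOrder Λ] {F : Type*} [Field F]

/-- The element `a` of `Λ`, seen as an element of `Λ + S`. -/
def toPlus (S : Finset Λ) (a : Λ) : PlusOrder Λ S := a

omit [Preorder Λ] [LocallyFiniteOrder Λ] in
@[simp]
theorem toPlus_inj {S : Finset Λ} {a b : Λ} : toPlus S a = toPlus S b ↔ a = b := Iff.rfl

/-- The element of `Λ` underlying an element of `Λ + S`. -/
def ofPlus (S : Finset Λ) (a : PlusOrder Λ S) : Λ := a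

omit [Preorder Λ] [LocallyFiniteOrder Λ] in
@[simp]
theorem ofPlus_inj {S : Finset Λ} {a b : PlusOrder Λ S} : ofPlus S a = ofPlus S b ↔ a = b :=
  Iff.rfl

omit [Preorder Λ] [LocallyFiniteOrder Λ] in
@[simp]
theorem toPlus_ofPlus {S : Finset Λ} (a : PlusOrder Λ S) : toPlus S (ofPlus S a) = a := rfl

omit [LocallyFiniteOrder Λ] in
theorem toPlus_le_toPlus {S : Finset Λ} {a b : Λ} (ha : a ∈ S) (hb : b ∈ S) :
    toPlus S a ≤ toPlus S b :=
  Or.inr ⟨a, ha, b, hb, le_refl a, le_refl b⟩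

namespace AlmostGL

/-- The inclusion of `GL_{Λ+S}(P)` into `aGL_Λ(P)`, as a group homomorphism. -/
noncomputable def ofGLHom {P : Type*} [CommRing P] (S : Finset Λ) :
    GLPlus Λ P S →* AlmostGL Λ P where
  toFun := ofGL
  map_one' := ofGL_one S
  map_mul' := ofGL_mul

open Classical in
/-- The elementary matrix `1 + c E_{ab}` as an element of `aGL_Λ(F)`. -/
noncomputable def elem {a b : Λ} (h : a ≠ b) (c : F) : AlmostGL Λ F :=
  ofGL (elemUnit (a := toPlus {a, b} a) (b := toPlus {a, b} b) h c)

open Classical in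
theorem toMatrix_elemUnit {S : Finset Λ} {a b : Λ} (ha : a ∈ S) (hb : b ∈ S) (h : a ≠ b) (c : F)
    (x y : Λ) :
    GLPlus.toMatrix (elemUnit (a := toPlus S a) (b := toPlus S b) h c) x y =
      (if x = y then 1 else 0) + if x = a ∧ y = b then c else 0 := by
  have hab := toPlus_le_toPlus ha hb
  change (1 : IncidenceAlgebra F (PlusOrder Λ S)) (toPlus S x) (toPlus S y) +
    matUnit (toPlus S a) (toPlus S b) c (toPlus S x) (toPlus S y) = _
  rw [IncidenceAlgebra.one_apply, matUnit_apply]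
  simp only [hab, true_and, toPlus_inj]

theorem ofGL_elemUnit {S : Finset Λ} {a b : Λ} (ha : a ∈ S) (hb : b ∈ S) (h : a ≠ b) (c : F) :
    ofGL (elemUnit (a := toPlus S a) (b := toPlus S b) h c) = elem h c := by
  classical
  refine Subtype.ext (funext fun x => funext fun y => ?_)
  exact (toMatrix_elemUnit ha hb h c x y).trans
    (toMatrix_elemUnit (S := {a, b}) (by simp) (by simp) h c x y).symm

open Classical in
theorem elem_val {a b : Λ} (h : a ≠ b) (c : F) (x y : Λ) :
    (elem h c).1 x y = (if x = y then 1 else 0) + if x = a ∧ y = b then c else 0 :=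
  toMatrix_elemUnit (by simp) (by simp) h c x y

/-- A scalar matrix is central. -/
theorem mem_center_of_scalar {A : AlmostGL Λ F} (h0 : ∀ i s, i ≠ s → A.1 i s = 0)
    (h1 : ∀ i j, A.1 i i = A.1 j j) : A ∈ Subgroup.center (AlmostGL Λ F) := by
  rw [Subgroup.mem_center_iff]
  intro B
  refine Subtype.ext (funext fun s => funext fun t => ?_)
  change ∑ᶠ u, B.1 s u * A.1 u t = ∑ᶠ u, A.1 s u * B.1 u t
  rw [finsum_eq_single _ t fun u hu => by rw [h0 u t hu, mul_zero],
    finsum_eq_single _ s fun u hu => by rw [h0 s u hu.symm, zero_mul], h1 s t, mul_comm]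

variable {N : Subgroup (AlmostGL Λ F)} [N.Normal]

/-- A normal subgroup which is not central contains a matrix that is not diagonal. -/
theorem exists_offDiag_ne_zero {A : AlmostGL Λ F} (hA : A ∈ N)
    (hc : A ∉ Subgroup.center (AlmostGL Λ F)) : ∃ B ∈ N, ∃ i s, i ≠ s ∧ B.1 i s ≠ 0 := by
  classical
  by_cases h0 : ∃ i s, i ≠ s ∧ A.1 i s ≠ 0
  · exact ⟨A, hA, h0⟩
  push Not at h0
  obtain ⟨i, j, hij⟩ : ∃ i j, A.1 i i ≠ A.1 j j := by
    by_contra! h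
    exact hc (mem_center_of_scalar h0 h)
  have hne : i ≠ j := fun h => hij (h ▸ rfl)
  -- Conjugating the diagonal matrix by `1 + E_{ij}` puts `A_{jj} - A_{ii}` at position `(i, j)`.
  obtain ⟨S₀, g₀, rfl⟩ := exists_ofGL A
  set S : Finset Λ := S₀ ∪ {i, j}
  have hi : i ∈ S := by simp [S]
  have hj : j ∈ S := by simp [S]
  set g : GLPlus Λ F S := GLPlus.incl Finset.subset_union_left g₀
  set E : GLPlus Λ F S := elemUnit (a := toPlus S i) (b := toPlus S j) hne 1
  refine ⟨ofGL (E * g * E⁻¹), ?_, i, j, hne, ?_⟩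
  · have h1 : g ∈ N.comap (ofGLHom S) := hA
    exact (inferInstance : (N.comap (ofGLHom S)).Normal).conj_mem g h1 E
  · let R := IncidenceAlgebra F (PlusOrder Λ S)
    have lij := toPlus_le_toPlus hi hj
    have lii := toPlus_le_toPlus hi hi
    have ljj := toPlus_le_toPlus hj hj
    set a : PlusOrder Λ S := toPlus S i with ha
    set b : PlusOrder Λ S := toPlus S j with hb
    let M : R := matUnit a b 1
    have hval : ((E * g * E⁻¹ : GLPlus Λ F S) : R) = (1 + M) * g * (1 - M) := rfl
    have key : matUnit a a (1 : F) * ((E * g * E⁻¹ : GLPlus Λ F S) : R) * matUnit b b (1 : F) =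
        matUnit a b ((g : R) a b + (g : R) b b - (g : R) a a - (g : R) b a) := by
      have e : matUnit a a (1 : F) * ((1 + M) * (g : R) * (1 - M)) * matUnit b b (1 : F) =
          matUnit a a (1 : F) * g * matUnit b b (1 : F) +
          (matUnit a a (1 : F) * M) * g * matUnit b b (1 : F) +
          -(matUnit a a (1 : F) * g * (M * matUnit b b (1 : F))) +
          -((matUnit a a (1 : F) * M) * g * (M * matUnit b b (1 : F))) := by noncomm_ring
      rw [hval, e, matUnit_mul lii lij, matUnit_mul lij ljj]
      simp only [matUnit_mul_mul lii ljj, matUnit_mul_mul lij ljj, matUnit_mul_mul lii lij,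
        matUnit_mul_mul lij lij, matUnit_neg, matUnit_add]
      congr 1; ring
    rw [matUnit_mul_mul lii ljj] at key
    have key2 := congrArg (fun f : R => f a b) key
    simp only [matUnit_apply_self lij, one_mul, mul_one] at key2
    change ((E * g * E⁻¹ : GLPlus Λ F S) : R) a b ≠ 0
    have e1 : (g : R) a b = 0 := h0 i j hne
    have e2 : (g : R) b a = 0 := h0 j i hne.symm
    have e3 : (g : R) a a ≠ (g : R) b b := hij
    rw [key2, e1, e2, zero_add, sub_zero]
    exact sub_ne_zero.2 e3.symm

/-- A normal subgroup which is not central contains a non-trivial elementary matrix. All indices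
involved are made equivalent by enlarging `S`. -/
theorem exists_elem_mem [Infinite Λ] {A : AlmostGL Λ F} (hA : A ∈ N)
    (hc : A ∉ Subgroup.center (AlmostGL Λ F)) :
    ∃ (a b : Λ) (h : a ≠ b) (c : F), c ≠ 0 ∧ elem h c ∈ N := by
  classical
  obtain ⟨B, hB, i, s, his, hBis⟩ := exists_offDiag_ne_zero hA hc
  obtain ⟨S₀, g₀, rfl⟩ := exists_ofGL B
  obtain ⟨u, hu⟩ : ∃ u, (g₀⁻¹).toMatrix i u ≠ 0 := by
    by_contra! h
    have h1 : (1 : IncidenceAlgebra F (PlusOrder Λ S₀)) (toPlus S₀ i) (toPlus S₀ i) = 0 := by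
      rw [← Units.inv_mul g₀, IncidenceAlgebra.mul_apply]
      exact Finset.sum_eq_zero fun u _ => by
        rw [show (↑g₀⁻¹ : IncidenceAlgebra F (PlusOrder Λ S₀)) (toPlus S₀ i) u = 0 from h u, zero_mul]
    simp at h1
  -- Two entries of the row `i` of `g₀⁻¹` satisfy a linear relation with leading coefficient `1`.
  obtain ⟨p, q, β, hpi, hqi, hpq, hβ⟩ : ∃ (p q : Λ) (β : F), p ≠ i ∧ q ≠ i ∧ p ≠ q ∧
      (g₀⁻¹).toMatrix i p + β * (g₀⁻¹).toMatrix i q = 0 := by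
    obtain ⟨p, hp⟩ := Infinite.exists_notMem_finset ({i} : Finset Λ)
    obtain ⟨q, hq⟩ := Infinite.exists_notMem_finset ({i, p} : Finset Λ)
    simp only [Finset.mem_insert, Finset.mem_singleton, not_or] at hp hq
    by_cases h : (g₀⁻¹).toMatrix i q = 0
    · exact ⟨q, p, 0, hq.1, hp, hq.2, by rw [h]; simp⟩
    · exact ⟨p, q, -((g₀⁻¹).toMatrix i p / (g₀⁻¹).toMatrix i q), hp, hq.1, Ne.symm hq.2,
        by field_simp; ring⟩
  obtain ⟨j, hj⟩ := Infinite.exists_notMem_finset ({u, p, q} : Finset Λ)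
  obtain ⟨m, hm⟩ := Infinite.exists_notMem_finset ({j, p} : Finset Λ)
  simp only [Finset.mem_insert, Finset.mem_singleton, not_or] at hj hm
  set S : Finset Λ := S₀ ∪ {i, s, u, p, q, j, m}
  set g : GLPlus Λ F S := GLPlus.incl Finset.subset_union_left g₀
  have hg : g ∈ N.comap (ofGLHom S) := hB
  have hginv : ∀ x y, (g⁻¹).toMatrix x y = (g₀⁻¹).toMatrix x y := fun x y => by
    rw [← map_inv, GLPlus.toMatrix_incl]
  have key := exists_elemUnit_mem hg (E := toPlus S '' S)
    (by rintro _ ⟨a, ha, rfl⟩ _ ⟨b, hb, rfl⟩; exact toPlus_le_toPlus ha hb)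
    (Set.mem_image_of_mem _ (show i ∈ S by simp [S]))
    (Set.mem_image_of_mem _ (show s ∈ S by simp [S]))
    (Set.mem_image_of_mem _ (show u ∈ S by simp [S]))
    (Set.mem_image_of_mem _ (show p ∈ S by simp [S]))
    (Set.mem_image_of_mem _ (show q ∈ S by simp [S]))
    (Set.mem_image_of_mem _ (show j ∈ S by simp [S]))
    (Set.mem_image_of_mem _ (show m ∈ S by simp [S])) his hpi hqi hpq hj.1 hj.2.1 hj.2.2 hm.1 hm.2
    (β := β)
    (by
      have h := hβ
      rw [← hginv, ← hginv] at h
      exact h)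
  refine ⟨m, j, hm.1, _, neg_ne_zero.2 (mul_ne_zero (a := g.toMatrix i s)
    (b := (g⁻¹).toMatrix i u) hBis (by rwa [hginv])), ?_⟩
  rw [← ofGL_elemUnit (S := S) (by simp [S]) (by simp [S])]
  exact key

theorem elem_comm_mem {a b c : Λ} (hab : a ≠ b) (hbc : b ≠ c) (hac : a ≠ c) (x y : F)
    (h : elem hab x ∈ N ∨ elem hbc y ∈ N) : elem hac (x * y) ∈ N := by
  classical
  let S : Finset Λ := {a, b, c}
  have ha : a ∈ S := by simp [S]
  have hb : b ∈ S := by simp [S]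
  have hc : c ∈ S := by simp [S]
  rw [← ofGL_elemUnit ha hb, ← ofGL_elemUnit hb hc] at h
  rw [← ofGL_elemUnit ha hc]
  exact elemUnit_comm_mem (N := N.comap (ofGLHom S)) hab hbc hac (toPlus_le_toPlus ha hb)
    (toPlus_le_toPlus hb hc) x y h

/-- A normal subgroup containing one non-trivial elementary matrix contains all of them. -/
theorem elem_mem_of_elem_mem [Infinite Λ] {m j : Λ} (hmj : m ≠ j) {c : F} (hc : c ≠ 0)
    (h : elem hmj c ∈ N) {a b : Λ} (hab : a ≠ b) (x : F) : elem hab x ∈ N := by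
  classical
  have h1 : ∀ (a : Λ) (haj : a ≠ j) (x : F), a ≠ m → elem haj x ∈ N := fun a haj x ham => by
    have := elem_comm_mem ham hmj haj (x / c) c (Or.inr h)
    rwa [div_mul_cancel₀ _ hc] at this
  have h2 : ∀ (a b : Λ) (hab : a ≠ b) (x : F), a ≠ m → a ≠ j → elem hab x ∈ N := by
    intro a b hab x ham haj
    by_cases hb : b = j
    · subst hb; exact h1 a _ x ham
    · have := elem_comm_mem haj (Ne.symm hb) hab x 1 (Or.inl (h1 a haj x ham))
      rwa [mul_one] at this
  obtain ⟨y, hy⟩ := Infinite.exists_notMem_finset ({m, j, a, b} : Finset Λ)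
  simp only [Finset.mem_insert, Finset.mem_singleton, not_or] at hy
  have := elem_comm_mem (Ne.symm hy.2.2.1) hy.2.2.2 hab 1 x
    (Or.inr (h2 y b hy.2.2.2 x hy.1 hy.2.1))
  rwa [one_mul] at this

end AlmostGL

end Elementary

/-! ### Diagonal matrices, finite matrices and truncations -/

section Finite

open Classical in
/-- A finite set of indices is contained in a finite order convex set. -/
theorem Finset.exists_ordConnected_superset {α : Type*} [Preorder α] [LocallyFiniteOrder α]
    (T : Finset α) :
    ∃ U : Finset α, T ⊆ U ∧ Set.OrdConnected (U : Set α) := by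
  refine ⟨T.biUnion fun a => T.biUnion fun b => Finset.Icc a b, fun x hx => ?_, ⟨?_⟩⟩
  · simp only [Finset.mem_biUnion, Finset.mem_Icc]
    exact ⟨x, hx, x, hx, le_rfl, le_rfl⟩
  · intro x hx y hy z hz
    simp only [Finset.coe_biUnion, Set.mem_iUnion, Finset.mem_coe, Finset.mem_Icc] at hx hy ⊢
    obtain ⟨a, ha, b, -, hax, -⟩ := hx
    obtain ⟨c, -, d, hd, -, hyd⟩ := hy
    exact ⟨a, ha, d, hd, hax.trans hz.1, hz.2.trans hyd⟩

namespace IncidenceAlgebra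

variable {F α : Type*} [Field F] [Preorder α] [LocallyFiniteOrder α]

/-- An entry of a product may be computed over any finite set outside which the terms vanish. -/
theorem mul_apply_eq_sum (f g : IncidenceAlgebra F α) (a b : α) (U : Finset α)
    (hU : ∀ x ∉ U, f a x * g x b = 0) : (f * g) a b = ∑ x ∈ U, f a x * g x b := by
  classical
  rw [mul_apply, Finset.sum_subset (Finset.subset_union_left (s₂ := U)),
    ← Finset.sum_subset (Finset.subset_union_right (s₁ := Finset.Icc a b))]
  · exact fun x _ hx => hU x hx
  · intro x _ hx
    by_contra h
    exact hx (Finset.mem_Icc.2 ⟨le_of_ne_zero (left_ne_zero_of_mul h),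
      le_of_ne_zero (right_ne_zero_of_mul h)⟩)

variable [DecidableEq α]

/-- Diagonal matrices, as a homomorphism into the incidence algebra. -/
def diagHom : (α → F) →* IncidenceAlgebra F α where
  toFun d := ⟨fun x y => if x = y then d x else 0, fun _ _ h => if_neg fun e => h e.le⟩
  map_one' := rfl
  map_mul' d e := by
    ext x y _
    rw [mul_apply_eq_sum _ _ _ _ {x} fun u hu => by
      rw [Finset.mem_singleton] at hu
      simp [Ne.symm hu]]
    by_cases h : x = y
    · subst h; simp
    · simp [h]

/-- Replacing all entries outside `T × T` by those of the identity matrix is multiplicative if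
`T` is order convex. -/
def truncHom (T : Finset α) (hT : Set.OrdConnected (T : Set α)) :
    IncidenceAlgebra F α →* IncidenceAlgebra F α where
  toFun f := ⟨fun x y => if x ∈ T ∧ y ∈ T then f x y else if x = y then 1 else 0, fun x y h => by
    rw [apply_eq_zero_of_not_le h, if_neg fun e => h (le_of_eq e), ite_self]⟩
  map_one' := by
    ext x y _
    simp
  map_mul' f g := by
    ext x y _
    by_cases hx : x ∈ T
    · rw [mul_apply_eq_sum _ _ _ _ T fun u hu => by
        have : x ≠ u := fun e => hu (e ▸ hx)
        simp [hu, this]]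
      by_cases hy : y ∈ T
      · have : (f * g) x y = ∑ u ∈ T, f x u * g u y := mul_apply_eq_sum _ _ _ _ _ fun u hu => by
          by_contra h
          exact hu (hT.out hx hy ⟨le_of_ne_zero (left_ne_zero_of_mul h),
            le_of_ne_zero (right_ne_zero_of_mul h)⟩)
        simp only [coe_mk, hx, hy, and_self, if_true, this]
        exact Finset.sum_congr rfl fun u hu => by simp [hu]
      · have : x ≠ y := fun e => hy (e ▸ hx)
        simp only [coe_mk, hy, and_false, if_false, this]
        refine (Finset.sum_eq_zero fun u hu => ?_).symm
        rw [if_neg (show ¬ u = y from fun e => hy (e ▸ hu)), mul_zero]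
    · rw [mul_apply_eq_sum _ _ _ _ {x} fun u hu => by
        rw [Finset.mem_singleton] at hu
        simp [Ne.symm hu, hx]]
      simp [hx]

theorem truncHom_apply (T : Finset α) (hT : Set.OrdConnected (T : Set α))
    (f : IncidenceAlgebra F α) (x y : α) :
    truncHom T hT f x y = if x ∈ T ∧ y ∈ T then f x y else if x = y then 1 else 0 := rfl

/-- Restriction of a matrix to the rows and columns in a finite order convex set is
multiplicative. -/
def restrHom {κ : Type*} [Fintype κ] [DecidableEq κ] (e : κ ↪ α)
    (he : Set.OrdConnected (Set.range e)) : IncidenceAlgebra F α →* Matrix κ κ F where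
  toFun f := Matrix.of fun x y => f (e x) (e y)
  map_one' := by
    ext x y
    rw [Matrix.of_apply, one_apply, Matrix.one_apply]
    simp only [e.apply_eq_iff_eq]
  map_mul' f g := by
    ext x y
    rw [Matrix.of_apply, Matrix.mul_apply, mul_apply_eq_sum _ _ _ _ (Finset.univ.map e),
      Finset.sum_map]
    · rfl
    intro u hu
    by_contra h
    obtain ⟨k, rfl⟩ := he.out ⟨x, rfl⟩ ⟨y, rfl⟩ ⟨le_of_ne_zero (left_ne_zero_of_mul h),
      le_of_ne_zero (right_ne_zero_of_mul h)⟩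
    exact hu (by simp)

end IncidenceAlgebra

variable {Λ : Type*} [Preorder Λ] [LocallyFiniteOrder Λ] {F : Type*} [Field F]

/-- The homomorphism from finite matrices indexed by `T` to the incidence algebra of `Λ + T`
which extends a matrix by the identity. -/
noncomputable def finExtHom [DecidableEq Λ] (T : Finset Λ) :
    Matrix T T F →* IncidenceAlgebra F (PlusOrder Λ T) where
  toFun M :=
    { toFun := fun x y =>
        if h : ofPlus T x ∈ T ∧ ofPlus T y ∈ T then M ⟨ofPlus T x, h.1⟩ ⟨ofPlus T y, h.2⟩
        else if ofPlus T x = ofPlus T y then 1 else 0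
      eq_zero_of_not_le' := fun x y h => by
        rw [dif_neg fun h' => h (toPlus_le_toPlus (a := ofPlus T x) (b := ofPlus T y) h'.1 h'.2),
          if_neg fun e => h (ofPlus_inj.1 e).le] }
  map_one' := by
    ext x y _
    rw [IncidenceAlgebra.one_apply, IncidenceAlgebra.coe_mk]
    split_ifs with h1 h2 h3 h4
    · exact Matrix.one_apply.trans (if_pos (Subtype.ext (ofPlus_inj.2 h2)))
    · exact Matrix.one_apply.trans (if_neg fun e => h2 (ofPlus_inj.1 (Subtype.ext_iff.1 e)))
    · rfl
    · exact absurd (ofPlus_inj.1 h3) h4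
    · exact absurd (ofPlus_inj.2 ‹_›) h3
    · rfl
  map_mul' M N := by
    ext x y _
    by_cases hx : ofPlus T x ∈ T
    · rw [IncidenceAlgebra.mul_apply_eq_sum _ _ _ _ (T.map ⟨toPlus T, fun _ _ => toPlus_inj.1⟩),
        Finset.sum_map]
      · simp only [IncidenceAlgebra.coe_mk]
        by_cases hy : ofPlus T y ∈ T
        · rw [dif_pos ⟨hx, hy⟩, Matrix.mul_apply, ← Finset.sum_coe_sort T]
          refine Finset.sum_congr rfl fun u _ => ?_
          rw [dif_pos ⟨hx, u.2⟩, dif_pos ⟨u.2, hy⟩]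
          rfl
        · rw [dif_neg fun h => hy h.2, if_neg fun e : ofPlus T x = ofPlus T y => hy (e ▸ hx)]
          refine (Finset.sum_eq_zero fun u hu => ?_).symm
          exact mul_eq_zero_of_right _ ((dif_neg fun h => hy h.2).trans
            (if_neg fun e : u = ofPlus T y => hy (e ▸ hu)))
      · intro u hu
        have hu' : ofPlus T u ∉ T := fun h => hu (Finset.mem_map.2 ⟨_, h, toPlus_ofPlus u⟩)
        rw [IncidenceAlgebra.coe_mk, IncidenceAlgebra.coe_mk,
          dif_neg (c := ofPlus T x ∈ T ∧ ofPlus T u ∈ T) fun h => hu' h.2,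
          if_neg fun e : ofPlus T x = ofPlus T u => hu' (e ▸ hx), zero_mul]
    · rw [IncidenceAlgebra.mul_apply_eq_sum _ _ _ _ {x}]
      · simp [hx]
      · intro u hu
        rw [Finset.mem_singleton] at hu
        rw [IncidenceAlgebra.coe_mk, IncidenceAlgebra.coe_mk,
          dif_neg (c := ofPlus T x ∈ T ∧ ofPlus T u ∈ T) fun h => hx h.1,
          if_neg fun e => hu (ofPlus_inj.1 e).symm, zero_mul]

namespace AlmostGL

/-- The element of `aGL_Λ(F)` extending an invertible finite matrix by the identity. -/
noncomputable def ofFinite [DecidableEq Λ] (T : Finset Λ) : (Matrix T T F)ˣ →* AlmostGL Λ F :=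
  (ofGLHom T).comp (Units.map (finExtHom T))

theorem ofFinite_val [DecidableEq Λ] (T : Finset Λ) (u : (Matrix T T F)ˣ) (x y : Λ) :
    (ofFinite T u).1 x y = if h : x ∈ T ∧ y ∈ T then (u : Matrix T T F) ⟨x, h.1⟩ ⟨y, h.2⟩
      else if x = y then 1 else 0 := rfl

/-- Invertible diagonal matrices as elements of `GL_{Λ+S}(F)`. -/
noncomputable def diagGL (S : Finset Λ) : (Λ → Fˣ) →* GLPlus Λ F S :=
  (Units.map (IncidenceAlgebra.diagHom (F := F) (α := PlusOrder Λ S))).comp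
    (MulEquiv.piUnits (M := fun _ : PlusOrder Λ S => F)).symm.toMonoidHom

open Classical in
theorem toMatrix_diagGL (S : Finset Λ) (d : Λ → Fˣ) (x y : Λ) :
    (diagGL S d).toMatrix x y = if x = y then (d x : F) else 0 := by
  change (if toPlus S x = toPlus S y then (d x : F) else 0) = _
  simp only [toPlus_inj]

/-- Invertible diagonal matrices as elements of `aGL_Λ(F)`. -/
noncomputable def diag : (Λ → Fˣ) →* AlmostGL Λ F := (ofGLHom ∅).comp (diagGL ∅)

theorem ofGL_diagGL (S : Finset Λ) (d : Λ → Fˣ) : ofGL (diagGL S d) = diag d := by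
  classical
  refine Subtype.ext (funext fun x => funext fun y => ?_)
  exact (toMatrix_diagGL S d x y).trans (toMatrix_diagGL ∅ d x y).symm

open Classical in
theorem diag_val (d : Λ → Fˣ) (x y : Λ) : (diag d).1 x y = if x = y then (d x : F) else 0 :=
  toMatrix_diagGL ∅ d x y

open Classical in
/-- The diagonal matrix with entries `c` and `c⁻¹` at `a` and `b` is a product of elementary
matrices. -/
theorem diag_eq_mul_elem {a b : Λ} (h : a ≠ b) (c : Fˣ) :
    diag (Pi.mulSingle a c * Pi.mulSingle b c⁻¹) =
      elem h (c : F) * elem h.symm (-(c : F)⁻¹) * elem h (c : F) *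
        (elem h (-1 : F) * elem h.symm (1 : F) * elem h (-1 : F)) := by
  let S : Finset Λ := {a, b}
  have ha : a ∈ S := by simp [S]
  have hb : b ∈ S := by simp [S]
  have haa := toPlus_le_toPlus ha ha
  have hab := toPlus_le_toPlus ha hb
  have hba := toPlus_le_toPlus hb ha
  have hbb := toPlus_le_toPlus hb hb
  have hne : toPlus S a ≠ toPlus S b := h
  -- The Weyl element `(1 + x E_{ab}) (1 - x⁻¹ E_{ba}) (1 + x E_{ab})`.
  have weyl : ∀ x y : F, x * y = -1 →
      (1 + matUnit (toPlus S a) (toPlus S b) x) * (1 + matUnit (toPlus S b) (toPlus S a) y) *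
        (1 + matUnit (toPlus S a) (toPlus S b) x) =
      1 + matUnit (toPlus S a) (toPlus S a) (-1) + matUnit (toPlus S b) (toPlus S b) (-1) +
        matUnit (toPlus S a) (toPlus S b) x + matUnit (toPlus S b) (toPlus S a) y := by
    intro x y hxy
    have hyx : y * x = -1 := by rw [mul_comm, hxy]
    have e : matUnit (toPlus S a) (toPlus S b) x + matUnit (toPlus S a) (toPlus S b) (-x) = 0 := by
      rw [matUnit_add, add_neg_cancel, matUnit_zero]
    simp only [mul_add, add_mul, one_mul, mul_one, matUnit_mul haa hab, matUnit_mul hab hba,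
      matUnit_mul hba hab, matUnit_mul_of_ne hne.symm, hxy, hyx, neg_mul, add_zero]
    rw [← sub_eq_zero]
    rw [← e]
    abel
  rw [← ofGL_elemUnit ha hb, ← ofGL_elemUnit hb ha, ← ofGL_elemUnit ha hb, ← ofGL_elemUnit hb ha,
    ← ofGL_mul, ← ofGL_mul, ← ofGL_mul, ← ofGL_mul, ← ofGL_mul,
    ← ofGL_diagGL S]
  congr 1
  refine Units.ext ?_
  have key : (1 + matUnit (toPlus S a) (toPlus S b) (c : F)) *
        (1 + matUnit (toPlus S b) (toPlus S a) (-(c : F)⁻¹)) *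
        (1 + matUnit (toPlus S a) (toPlus S b) (c : F)) *
      ((1 + matUnit (toPlus S a) (toPlus S b) (-1 : F)) *
        (1 + matUnit (toPlus S b) (toPlus S a) (1 : F)) *
        (1 + matUnit (toPlus S a) (toPlus S b) (-1 : F))) =
      1 + matUnit (toPlus S a) (toPlus S a) ((c : F) - 1) +
        matUnit (toPlus S b) (toPlus S b) ((c : F)⁻¹ - 1) := by
    rw [weyl _ _ (by simp), weyl _ _ (by simp)]
    simp only [mul_add, add_mul, one_mul, mul_one, matUnit_mul haa haa, matUnit_mul haa hab,
      matUnit_mul hab hba, matUnit_mul hab hbb, matUnit_mul hba haa, matUnit_mul hba hab,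
      matUnit_mul hbb hba, matUnit_mul hbb hbb, matUnit_mul_of_ne hne.symm,
      matUnit_mul_of_ne hne, sub_eq_add_neg, ← matUnit_add, neg_mul, mul_neg,
      ← matUnit_neg]
    abel
  refine Eq.trans ?_ key.symm
  ext x y _
  obtain ⟨x, rfl⟩ : ∃ x', toPlus S x' = x := ⟨x, rfl⟩
  obtain ⟨y, rfl⟩ : ∃ y', toPlus S y' = y := ⟨y, rfl⟩
  refine (toMatrix_diagGL S _ x y).trans ?_
  simp only [IncidenceAlgebra.add_apply, IncidenceAlgebra.one_apply, matUnit_apply, haa, hbb,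
    true_and, toPlus_inj, Pi.mul_apply, Pi.mulSingle_apply]
  by_cases hxy : x = y
  · subst hxy
    by_cases hxa : x = a
    · subst hxa
      simp [h]
    · by_cases hxb : x = b
      · subst hxb
        simp [hxa]
      · simp [hxa, hxb]
  · have h1 : ¬ (x = a ∧ y = a) := fun e => hxy (e.1.trans e.2.symm)
    have h2 : ¬ (x = b ∧ y = b) := fun e => hxy (e.1.trans e.2.symm)
    simp [hxy, h1, h2]

end AlmostGL

end Finite

/-! ### Closed normal subgroups of the almost general linear group -/

section Density

variable {Λ : Type*} [Preorder Λ] [LocallyFiniteOrder Λ] {F : Type*} [Field F]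
  [TopologicalSpace F]

namespace AlmostGL

open Filter Topology in
/-- In the final topology, approximation on all finite sets of entries within a fixed `GL_{Λ+S}(F)`
suffices for an element to lie in a closed set. -/
theorem mem_of_approx {C : Set (AlmostGL Λ F)} (hC : IsClosed C) {S : Finset Λ}
    (u : GLPlus Λ F S)
    (h : ∀ T : Finset Λ, ∃ v : GLPlus Λ F S, ofGL v ∈ C ∧
      ∀ a ∈ T, ∀ b ∈ T, v.toMatrix a b = u.toMatrix a b) : ofGL u ∈ C := by
  classical
  have h1 := isClosed_coinduced.1 (isClosed_iSup_iff.1 hC S)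
  obtain ⟨D, hD, hDC⟩ := isClosed_induced_iff.1 h1
  choose v hv hvu using h
  have hmem : ∀ w : GLPlus Λ F S, w.toMatrix ∈ D ↔ ofGL w ∈ C := fun w =>
    Set.ext_iff.1 hDC w
  rw [← hmem]
  refine hD.mem_of_tendsto (f := fun T => (v T).toMatrix) (b := atTop) ?_
    (Eventually.of_forall fun T => (hmem _).2 (hv T))
  refine tendsto_pi_nhds.2 fun a => tendsto_pi_nhds.2 fun b => ?_
  refine tendsto_const_nhds.congr' ?_
  filter_upwards [eventually_ge_atTop ({a, b} : Finset Λ)] with T hT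
  exact (hvu T a (hT (by simp)) b (hT (by simp))).symm

variable [Infinite Λ] {N : Subgroup (AlmostGL Λ F)}

open Classical in
/-- The matrices `diag(c, c⁻¹)` with `c⁻¹` at position `n` tend to `diag(c, 1)` as `n` leaves all
finite sets; this is where the determinant obstruction disappears. -/
theorem diag_mulSingle_mem (hN : IsClosed (N : Set (AlmostGL Λ F)))
    (hE : ∀ (a b : Λ) (h : a ≠ b) (c : F), elem h c ∈ N) (a : Λ) (c : Fˣ) :
    diag (Pi.mulSingle a c) ∈ N := by
  rw [← ofGL_diagGL ∅]
  refine mem_of_approx hN _ fun T => ?_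
  obtain ⟨n, hn⟩ := Infinite.exists_notMem_finset (insert a T)
  rw [Finset.mem_insert, not_or] at hn
  refine ⟨diagGL ∅ (Pi.mulSingle a c * Pi.mulSingle n c⁻¹), ?_, fun x hx y hy => ?_⟩
  · rw [ofGL_diagGL, diag_eq_mul_elem (Ne.symm hn.1)]
    exact N.mul_mem (N.mul_mem (N.mul_mem (hE _ _ _ _) (hE _ _ _ _)) (hE _ _ _ _))
      (N.mul_mem (N.mul_mem (hE _ _ _ _) (hE _ _ _ _)) (hE _ _ _ _))
  · have : x ≠ n := fun e => hn.2 (e ▸ hx)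
    simp only [toMatrix_diagGL, Pi.mul_apply, Pi.mulSingle_eq_of_ne this, mul_one]

/-- Invertible finite matrices are products of elementary and diagonal ones. -/
theorem ofFinite_mem [DecidableEq Λ] (hN : IsClosed (N : Set (AlmostGL Λ F)))
    (hE : ∀ (a b : Λ) (h : a ≠ b) (c : F), elem h c ∈ N) (T : Finset Λ) (u : (Matrix T T F)ˣ) :
    ofFinite T u ∈ N := by
  have hdet : (u : Matrix T T F).det ≠ 0 := ((Matrix.isUnit_iff_isUnit_det _).1 u.isUnit).ne_zero
  suffices H : ∀ v : (Matrix T T F)ˣ, (v : Matrix T T F) = u → ofFinite T v ∈ N from H u rfl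
  refine Matrix.diagonal_transvection_induction_of_det_ne_zero
    (fun M => ∀ v : (Matrix T T F)ˣ, (v : Matrix T T F) = M → ofFinite T v ∈ N) _ hdet ?_ ?_ ?_
  · intro D hD v hv
    rw [Matrix.det_diagonal, Finset.prod_ne_zero_iff] at hD
    let d : Λ → Fˣ := fun x => if h : x ∈ T then Units.mk0 (D ⟨x, h⟩) (hD _ (Finset.mem_univ _))
      else 1
    have key : ofFinite T v = diag (∏ t ∈ T, Pi.mulSingle t (d t)) := by
      refine Subtype.ext (funext fun x => funext fun y => ?_)
      rw [ofFinite_val, diag_val, Finset.prod_apply]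
      simp only [Pi.mulSingle_apply, Finset.prod_ite_eq, hv, Matrix.diagonal_apply,
        Subtype.mk.injEq]
      by_cases hxy : x = y
      · subst hxy
        by_cases hx : x ∈ T <;> simp [hx, d]
      · simp [hxy]
    rw [key]
    refine (N.comap diag).prod_mem fun t _ => ?_
    change diag _ ∈ N
    convert diag_mulSingle_mem hN hE t (d t)
  · intro t v hv
    have hij : (t.i : Λ) ≠ t.j := fun e => t.hij (Subtype.ext e)
    have key : ofFinite T v = elem hij t.c := by
      refine Subtype.ext (funext fun x => funext fun y => ?_)
      rw [ofFinite_val, elem_val, hv]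
      by_cases h : x ∈ T ∧ y ∈ T
      · rw [dif_pos h, Matrix.TransvectionStruct.toMatrix, Matrix.transvection, Matrix.add_apply,
          Matrix.one_apply, Matrix.single_apply]
        simp only [Subtype.ext_iff, eq_comm]
        congr
      · have h' : ¬ (x = t.i ∧ y = t.j) := by
          rintro ⟨rfl, rfl⟩
          exact h ⟨t.i.2, t.j.2⟩
        rw [dif_neg h, if_neg h', add_zero]
        congr
    rw [key]
    exact hE _ _ _ _
  · intro A B hA hB hPA hPB v hv
    have e : v = Matrix.GeneralLinearGroup.mkOfDetNeZero A hA *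
        Matrix.GeneralLinearGroup.mkOfDetNeZero B hB := Units.ext hv
    rw [e, map_mul]
    exact N.mul_mem (hPA _ rfl) (hPB _ rfl)

/-- A closed subgroup containing all elementary matrices is everything, because every element is
approximated by its truncations to finite order convex sets. -/
theorem eq_top_of_elem_mem (hN : IsClosed (N : Set (AlmostGL Λ F)))
    (hE : ∀ (a b : Λ) (h : a ≠ b) (c : F), elem h c ∈ N) : N = ⊤ := by
  classical
  refine eq_top_iff.2 fun A _ => ?_
  obtain ⟨S, u, rfl⟩ := exists_ofGL A
  refine mem_of_approx hN u fun T₀ => ?_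
  obtain ⟨U, hU₀, hU⟩ := Finset.exists_ordConnected_superset
    (T₀.map ⟨toPlus S, fun _ _ => toPlus_inj.1⟩)
  let T : Finset Λ := U.map ⟨ofPlus S, fun _ _ => ofPlus_inj.1⟩
  have hTU : ∀ x, x ∈ T ↔ toPlus S x ∈ U := fun x =>
    Finset.mem_map' (f := ⟨ofPlus S, fun _ _ => ofPlus_inj.1⟩) (a := toPlus S x)
  let e : T ↪ PlusOrder Λ S := ⟨fun t => toPlus S t, fun _ _ h => Subtype.ext h⟩
  have he : Set.range e = U := by
    ext x
    exact ⟨fun ⟨t, ht⟩ => ht ▸ (hTU t).1 t.2, fun hx => ⟨⟨ofPlus S x, (hTU _).2 hx⟩, rfl⟩⟩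
  refine ⟨Units.map (IncidenceAlgebra.truncHom (F := F) U hU) u, ?_, fun a ha b hb => ?_⟩
  · have key : ofGL (Units.map (IncidenceAlgebra.truncHom (F := F) U hU) u) =
        ofFinite T (Units.map (IncidenceAlgebra.restrHom (F := F) e (he ▸ hU)) u) := by
      refine Subtype.ext (funext fun x => funext fun y => ?_)
      rw [ofFinite_val]
      refine (IncidenceAlgebra.truncHom_apply U hU _ (toPlus S x) (toPlus S y)).trans ?_
      simp only [hTU, toPlus_inj]
      by_cases h : toPlus S x ∈ U ∧ toPlus S y ∈ U
      · rw [if_pos h, dif_pos h]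
        rfl
      · rw [if_neg h, dif_neg h]
    rw [key]
    exact ofFinite_mem hN hE _ _
  · exact if_pos ⟨hU₀ (Finset.mem_map_of_mem _ ha), hU₀ (Finset.mem_map_of_mem _ hb)⟩

/-- A closed normal subgroup which is not central is everything. -/
theorem eq_top_of_not_le_center [N.Normal] (hN : IsClosed (N : Set (AlmostGL Λ F)))
    (hc : ¬ N ≤ Subgroup.center (AlmostGL Λ F)) : N = ⊤ := by
  obtain ⟨A, hA, hAc⟩ := Set.not_subset.1 hc
  obtain ⟨m, j, hmj, c, hc0, hmem⟩ := exists_elem_mem hA hAc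
  exact eq_top_of_elem_mem hN fun a b h x => elem_mem_of_elem_mem hmj hc0 hmem h x

end AlmostGL

theorem isTopologicallySimple_almostPGL [Infinite Λ] :
    IsTopologicallySimple (AlmostPGL Λ F) := by
  classical
  refine ⟨?_, fun N hN hNc => ?_⟩
  · obtain ⟨a, b, hab⟩ := exists_pair_ne Λ
    obtain ⟨m, hm⟩ := Infinite.exists_notMem_finset ({a, b} : Finset Λ)
    simp only [Finset.mem_insert, Finset.mem_singleton, not_or] at hm
    refine ⟨QuotientGroup.mk (AlmostGL.elem hab (1 : F)), 1, fun h => ?_⟩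
    -- The elementary matrices at `(a, b)` and `(b, m)` do not commute.
    have hcomm := Subgroup.mem_center_iff.1 ((QuotientGroup.eq_one_iff _).1 h)
      (AlmostGL.elem (Ne.symm hm.2) 1)
    have key := congrFun (congrFun (congrArg Subtype.val hcomm) a) m
    change ∑ᶠ u, (AlmostGL.elem (Ne.symm hm.2) (1 : F)).1 a u * (AlmostGL.elem hab 1).1 u m =
      ∑ᶠ u, (AlmostGL.elem hab (1 : F)).1 a u * (AlmostGL.elem (Ne.symm hm.2) 1).1 u m at key
    rw [finsum_eq_single _ a fun u hu => by simp [AlmostGL.elem_val, Ne.symm hu, hab],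
      finsum_eq_single _ b fun u hu => by
        by_cases hua : u = a
        · subst hua
          simp [AlmostGL.elem_val, hab, Ne.symm hm.1]
        · simp [AlmostGL.elem_val, hu, Ne.symm hua]] at key
    simp [AlmostGL.elem_val, hab, Ne.symm hm.1, Ne.symm hm.2] at key
    exact hm.2 key
  · let M := N.comap (QuotientGroup.mk' (Subgroup.center (AlmostGL Λ F)))
    have hM : IsClosed (M : Set (AlmostGL Λ F)) := hNc.preimage continuous_quot_mk
    have hsurj := QuotientGroup.mk'_surjective (Subgroup.center (AlmostGL Λ F))
    by_cases h : M ≤ Subgroup.center (AlmostGL Λ F)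
    · left
      refine (Subgroup.eq_bot_iff_forall _).2 fun x hx => ?_
      obtain ⟨y, rfl⟩ := hsurj x
      exact (QuotientGroup.eq_one_iff y).2 (h hx)
    · right
      have h1 : M = ⊤ := AlmostGL.eq_top_of_not_le_center hM h
      refine eq_top_iff.2 fun x _ => ?_
      obtain ⟨y, rfl⟩ := hsurj x
      exact (h1 ▸ Subgroup.mem_top y : y ∈ M)

end Density

/-! ### The compact groups `GL_{Λ+S}(F)` -/

section CompactGroups

open Topology

/-- The incidence algebra carries the subspace topology of the product topology. -/
instance IncidenceAlgebra.instTopologicalSpace {F α : Type*} [Zero F] [LE α]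
    [TopologicalSpace F] : TopologicalSpace (IncidenceAlgebra F α) :=
  TopologicalSpace.induced (fun f a b => f a b) inferInstance

namespace IncidenceAlgebra

variable {F α : Type*} [Field F] [TopologicalSpace F] [Preorder α]

theorem isEmbedding_coe : IsEmbedding (fun (f : IncidenceAlgebra F α) a b => f a b) :=
  ⟨⟨rfl⟩, DFunLike.coe_injective⟩

theorem continuous_apply (a b : α) : Continuous fun f : IncidenceAlgebra F α => f a b :=
  (_root_.continuous_apply_apply a b).comp isEmbedding_coe.continuous

theorem continuous_of_apply {X : Type*} [TopologicalSpace X] {φ : X → IncidenceAlgebra F α}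
    (h : ∀ a b, Continuous fun x => φ x a b) : Continuous φ :=
  isEmbedding_coe.continuous_iff.2 (continuous_pi fun a => continuous_pi fun b => h a b)

theorem isClosedEmbedding_coe [T1Space F] :
    IsClosedEmbedding (fun (f : IncidenceAlgebra F α) a b => f a b) := by
  refine ⟨isEmbedding_coe, ?_⟩
  have : Set.range (fun (f : IncidenceAlgebra F α) a b => f a b) =
      ⋂ (a : α) (b : α) (_ : ¬ a ≤ b), (fun f : α → α → F => f a b) ⁻¹' {0} := by
    ext f
    simp only [Set.mem_range, Set.mem_iInter, Set.mem_preimage, Set.mem_singleton_iff]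
    exact ⟨fun ⟨g, hg⟩ a b h => hg ▸ apply_eq_zero_of_not_le h g, fun h =>
      ⟨⟨f, fun a b hab => h a b hab⟩, rfl⟩⟩
  rw [this]
  exact isClosed_iInter fun a => isClosed_iInter fun b => isClosed_iInter fun _ =>
    isClosed_singleton.preimage (_root_.continuous_apply_apply a b)

instance [T2Space F] : T2Space (IncidenceAlgebra F α) := isEmbedding_coe.t2Space

instance [T1Space F] [CompactSpace F] : CompactSpace (IncidenceAlgebra F α) :=
  isClosedEmbedding_coe.compactSpace

instance [LocallyFiniteOrder α] [IsTopologicalRing F] : ContinuousMul (IncidenceAlgebra F α) where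
  continuous_mul := continuous_of_apply fun a b => by
    simp only [mul_apply]
    exact continuous_finsetSum _ fun x _ => ((continuous_apply a x).comp continuous_fst).mul
      ((continuous_apply x b).comp continuous_snd)

end IncidenceAlgebra

variable {F : Type*} [Field F] [TopologicalSpace F] {Λ : Type*} [Preorder Λ]
  [LocallyFiniteOrder Λ]

theorem GLPlus.continuous_toMatrix (S : Finset Λ) :
    Continuous fun u : GLPlus Λ F S => u.toMatrix :=
  continuous_pi fun a => continuous_pi fun b =>
    (IncidenceAlgebra.continuous_apply (toPlus S a) (toPlus S b)).comp Units.continuous_val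

omit [TopologicalSpace F] in
theorem GLPlus.toMatrix_injective (S : Finset Λ) :
    Function.Injective fun u : GLPlus Λ F S => u.toMatrix :=
  fun _ _ h => Units.ext (DFunLike.coe_injective h)

variable [Finite F] [DiscreteTopology F]

/-- On `GL_{Λ+S}(F)` the topology of the group of units and the topology of entrywise convergence
agree, because the former is compact. -/
theorem GLPlus.isClosedEmbedding_toMatrix (S : Finset Λ) :
    IsClosedEmbedding fun u : GLPlus Λ F S => u.toMatrix :=
  have : T2Space (Matrix Λ Λ F) := inferInstanceAs (T2Space (Λ → Λ → F))
  (GLPlus.continuous_toMatrix S).isClosedEmbedding (GLPlus.toMatrix_injective S)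

instance GLPlus.totallyDisconnectedSpace (S : Finset Λ) :
    TotallyDisconnectedSpace (GLPlus Λ F S) :=
  have : TotallyDisconnectedSpace (Matrix Λ Λ F) :=
    inferInstanceAs (TotallyDisconnectedSpace (Λ → Λ → F))
  (GLPlus.isClosedEmbedding_toMatrix S).isEmbedding.isTotallyDisconnected_range.1
    (isTotallyDisconnected_of_totallyDisconnectedSpace _)

theorem GLPlus.secondCountableTopology [Countable Λ] (S : Finset Λ) :
    SecondCountableTopology (GLPlus Λ F S) :=
  have : SecondCountableTopology (Matrix Λ Λ F) :=
    inferInstanceAs (SecondCountableTopology (Λ → Λ → F))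
  (GLPlus.isClosedEmbedding_toMatrix S).isEmbedding.secondCountableTopology

theorem GLPlus.continuous_incl {S S' : Finset Λ} (h : S ⊆ S') :
    Continuous (GLPlus.incl h : GLPlus Λ F S →* GLPlus Λ F S') :=
  (GLPlus.isClosedEmbedding_toMatrix S').isEmbedding.continuous_iff.2
    (GLPlus.continuous_toMatrix S)

/-! ### The direct limit topology -/

namespace AlmostGL

theorem continuous_dom {X : Type*} [TopologicalSpace X] {φ : AlmostGL Λ F → X} :
    Continuous φ ↔ ∀ S : Finset Λ, Continuous fun u : GLPlus Λ F S => φ (ofGL u) := by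
  refine continuous_iSup_dom.trans (forall_congr' fun S => ?_)
  rw [continuous_coinduced_dom]
  rw [show (TopologicalSpace.induced (fun u : GLPlus Λ F S => u.toMatrix) inferInstance) =
    Units.instTopologicalSpaceUnits from
    (GLPlus.isClosedEmbedding_toMatrix S).isEmbedding.eq_induced.symm]
  rfl

theorem isClosed_iff {C : Set (AlmostGL Λ F)} :
    IsClosed C ↔ ∀ S : Finset Λ, IsClosed ((fun u : GLPlus Λ F S => ofGL u) ⁻¹' C) := by
  refine isClosed_iSup_iff.trans (forall_congr' fun S => ?_)
  rw [isClosed_coinduced]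
  rw [show (TopologicalSpace.induced (fun u : GLPlus Λ F S => u.toMatrix) inferInstance) =
    Units.instTopologicalSpaceUnits from
    (GLPlus.isClosedEmbedding_toMatrix S).isEmbedding.eq_induced.symm]

theorem isOpen_iff {C : Set (AlmostGL Λ F)} :
    IsOpen C ↔ ∀ S : Finset Λ, IsOpen ((fun u : GLPlus Λ F S => ofGL u) ⁻¹' C) := by
  simp only [← isClosed_compl_iff, isClosed_iff, Set.preimage_compl]

theorem continuous_ofGL (S : Finset Λ) : Continuous fun u : GLPlus Λ F S => ofGL u :=
  continuous_dom.1 continuous_id S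

omit [TopologicalSpace F] [Finite F] [DiscreteTopology F] in
theorem ofGL_injective (S : Finset Λ) : Function.Injective fun u : GLPlus Λ F S => ofGL u :=
  fun _ _ h => GLPlus.toMatrix_injective S (congrArg Subtype.val h)

/-- The inclusions of the compact groups `GL_{Λ+S}(F)` are closed maps: any two of them land in a
third one. -/
theorem isClosedMap_ofGL (S : Finset Λ) : IsClosedMap fun u : GLPlus Λ F S => ofGL u := by
  classical
  intro C hC
  refine isClosed_iff.2 fun T => ?_
  have h1 : IsClosed (GLPlus.incl (P := F) (Finset.subset_union_left (s₁ := S) (s₂ := T)) '' C) :=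
    (hC.isCompact.image (GLPlus.continuous_incl _)).isClosed
  convert h1.preimage (GLPlus.continuous_incl (Finset.subset_union_right (s₁ := S) (s₂ := T)))
    using 1
  ext u
  constructor
  · rintro ⟨v, hv, e⟩
    exact ⟨v, hv, ofGL_injective (S ∪ T) e⟩
  · rintro ⟨v, hv, e⟩
    exact ⟨v, hv, congrArg ofGL e⟩

theorem continuous_mul_left (A : AlmostGL Λ F) : Continuous fun B => A * B := by
  classical
  obtain ⟨S, u, rfl⟩ := exists_ofGL A
  refine continuous_dom.2 fun T => ?_
  have e : (fun v : GLPlus Λ F T => ofGL u * ofGL v) = fun v => ofGL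
      (GLPlus.incl (Finset.subset_union_left (s₂ := T)) u *
        GLPlus.incl (Finset.subset_union_right (s₁ := S)) v) := by
    funext v
    rw [ofGL_mul, ofGL_incl, ofGL_incl]
  rw [e]
  exact (continuous_ofGL _).comp (continuous_const.mul (GLPlus.continuous_incl _))

theorem continuous_inv : Continuous fun A : AlmostGL Λ F => A⁻¹ := by
  refine continuous_dom.2 fun T => ?_
  have e : (fun v : GLPlus Λ F T => (ofGL v)⁻¹) = fun v => ofGL v⁻¹ :=
    funext fun v => (map_inv (ofGLHom T) v).symm
  rw [e]
  exact (continuous_ofGL _).comp ContinuousInv.continuous_inv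

theorem continuous_mul_right (A : AlmostGL Λ F) : Continuous fun B => B * A := by
  have e : (fun B => B * A) = fun B => (A⁻¹ * B⁻¹)⁻¹ := by
    funext B
    group
  rw [e]
  exact continuous_inv.comp ((continuous_mul_left _).comp continuous_inv)

end AlmostGL

end CompactGroups

/-! ### Open subgroups in the countable case -/

section Countable

open Topology Filter

/-- A closed subgroup of a profinite group contained in an open set is contained in an open
subgroup contained in that set. -/
theorem Subgroup.exists_isOpen_ge {G : Type*} [Group G] [TopologicalSpace G]
    [IsTopologicalGroup G] [CompactSpace G] [TotallyDisconnectedSpace G] {L : Subgroup G}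
    (hL : IsClosed (L : Set G)) {U : Set G} (hU : IsOpen U) (hLU : (L : Set G) ⊆ U) :
    ∃ M : Subgroup G, L ≤ M ∧ IsOpen (M : Set G) ∧ (M : Set G) ⊆ U := by
  obtain ⟨V, hV, hVU⟩ := compact_open_separated_mul_right hL.isCompact hU hLU
  obtain ⟨W, hWV, hW, h1⟩ := mem_nhds_iff.1 hV
  obtain ⟨O, hO⟩ := ProfiniteGrp.exist_openNormalSubgroup_sub_open_nhds_of_one hW h1
  refine ⟨L ⊔ O.toSubgroup, le_sup_left, Subgroup.isOpen_mono le_sup_right O.isOpen, ?_⟩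
  rw [Subgroup.mul_normal]
  exact (Set.mul_subset_mul_left (hO.trans hWV)).trans hVU

/-- A group with continuous translations and inversion in which the open subgroups form a
neighbourhood basis of the identity is a nonarchimedean topological group. -/
theorem nonarchimedeanGroup_of_exists_subgroup {G : Type*} [Group G] [TopologicalSpace G]
    (hl : ∀ a : G, Continuous fun b => a * b) (hr : ∀ a : G, Continuous fun b => b * a)
    (hi : Continuous fun a : G => a⁻¹)
    (h : ∀ U : Set G, IsOpen U → 1 ∈ U →
      ∃ L : Subgroup G, IsOpen (L : Set G) ∧ (L : Set G) ⊆ U) : NonarchimedeanGroup G := by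
  have key : ∀ U ∈ 𝓝 (1 : G), ∃ L : Subgroup G, IsOpen (L : Set G) ∧ (L : Set G) ⊆ U := by
    intro U hU
    obtain ⟨W, hWU, hW, h1⟩ := mem_nhds_iff.1 hU
    obtain ⟨L, hL, hLW⟩ := h W hW h1
    exact ⟨L, hL, hLW.trans hWU⟩
  have : IsTopologicalGroup G := by
    refine IsTopologicalGroup.of_nhds_one ?_ ?_ ?_ ?_
    · intro U hU
      obtain ⟨L, hL, hLU⟩ := key U hU
      have hL1 : (L : Set G) ∈ 𝓝 (1 : G) := hL.mem_nhds L.one_mem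
      refine mem_map.2 (mem_of_superset (prod_mem_prod hL1 hL1) ?_)
      exact fun p hp => hLU (L.mul_mem hp.1 hp.2)
    · simpa using hi.tendsto 1
    · intro a
      let e : G ≃ₜ G :=
        { Equiv.mulLeft a with
          continuous_toFun := hl a
          continuous_invFun := hl a⁻¹ }
      have := e.map_nhds_eq 1
      rw [show e 1 = a from mul_one a] at this
      exact this.symm
    · intro a
      have : Tendsto (fun x => a * x * a⁻¹) (𝓝 1) (𝓝 (a * 1 * a⁻¹)) :=
        ((hr a⁻¹).comp (hl a)).tendsto 1
      rwa [mul_one, mul_inv_cancel] at this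
  refine ⟨fun U hU => ?_⟩
  obtain ⟨L, hL, hLU⟩ := key U hU
  exact ⟨⟨L, hL⟩, hLU⟩

/-- A countable type has an increasing sequence of finite sets that is cofinal among all finite
sets. -/
theorem exists_monotone_exhaustion (Λ : Type*) [Countable Λ] :
    ∃ S : ℕ → Finset Λ, Monotone S ∧ ∀ T : Finset Λ, ∃ n, T ⊆ S n := by
  classical
  obtain ⟨f, hf⟩ := exists_injective_nat Λ
  have hfin : ∀ n, {a : Λ | f a ≤ n}.Finite := fun n =>
    (Set.finite_Iic n).preimage hf.injOn
  refine ⟨fun n => (hfin n).toFinset, fun m n hmn a ha => ?_, fun T => ⟨T.sup f, fun a ha => ?_⟩⟩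
  · rw [Set.Finite.mem_toFinset] at ha ⊢
    exact le_trans ha hmn
  · rw [Set.Finite.mem_toFinset]
    exact Finset.le_sup (f := f) ha

variable {F : Type*} [Field F] [TopologicalSpace F] [Finite F] [DiscreteTopology F]
  {Λ : Type*} [Preorder Λ] [LocallyFiniteOrder Λ]

namespace AlmostGL

section

variable [Countable Λ]

/-- The open subgroup is the union of an increasing sequence of compact subgroups `L n`, with
`L n` open in the `n`-th member of an exhaustion by compact groups. -/
theorem exists_subgroup_isOpen {U : Set (AlmostGL Λ F)} (hU : IsOpen U) (h1 : 1 ∈ U) :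
    ∃ L : Subgroup (AlmostGL Λ F), IsOpen (L : Set (AlmostGL Λ F)) ∧
      (L : Set (AlmostGL Λ F)) ⊆ U := by
  obtain ⟨S, hS, hcof⟩ := exists_monotone_exhaustion Λ
  have hUS : ∀ n, IsOpen ((fun u : GLPlus Λ F (S n) => ofGL u) ⁻¹' U) := fun n =>
    hU.preimage (continuous_ofGL _)
  have step : ∀ (n : ℕ) (L : Subgroup (AlmostGL Λ F)), IsClosed (L : Set (AlmostGL Λ F)) →
      (L : Set (AlmostGL Λ F)) ⊆ U → L ≤ (ofGLHom (S n)).range →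
      ∃ M : Subgroup (AlmostGL Λ F), L ≤ M ∧ IsClosed (M : Set (AlmostGL Λ F)) ∧
        (M : Set (AlmostGL Λ F)) ⊆ U ∧ M ≤ (ofGLHom (S n)).range ∧
        IsOpen ((M.comap (ofGLHom (S n)) : Subgroup (GLPlus Λ F (S n))) :
          Set (GLPlus Λ F (S n))) := by
    intro n L hL hLU hLn
    obtain ⟨M, hLM, hM, hMU⟩ := Subgroup.exists_isOpen_ge (L := L.comap (ofGLHom (S n)))
      (hL.preimage (continuous_ofGL (S n))) (hUS n) fun u hu => hLU hu
    refine ⟨M.map (ofGLHom (S n)), ?_, ?_, ?_, Subgroup.map_le_range _ _, ?_⟩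
    · intro A hA
      obtain ⟨u, rfl⟩ := hLn hA
      exact ⟨u, hLM hA, rfl⟩
    · exact isClosedMap_ofGL (S n) _ (M.isClosed_of_isOpen hM)
    · rintro _ ⟨u, hu, rfl⟩
      exact hMU hu
    · rwa [Subgroup.comap_map_eq_self_of_injective (ofGL_injective (S n))]
  have hmono : ∀ n, (ofGLHom (P := F) (S n)).range ≤ (ofGLHom (S (n + 1))).range := by
    rintro n _ ⟨u, rfl⟩
    exact ⟨GLPlus.incl (hS n.le_succ) u, rfl⟩
  let Good : ℕ → Type _ := fun n => {L : Subgroup (AlmostGL Λ F) //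
    IsClosed (L : Set (AlmostGL Λ F)) ∧ (L : Set (AlmostGL Λ F)) ⊆ U ∧
      L ≤ (ofGLHom (S n)).range ∧
      IsOpen ((L.comap (ofGLHom (S n)) : Subgroup (GLPlus Λ F (S n))) : Set (GLPlus Λ F (S n)))}
  have hbot : IsClosed ((⊥ : Subgroup (AlmostGL Λ F)) : Set (AlmostGL Λ F)) := by
    have := isClosedMap_ofGL (F := F) (∅ : Finset Λ) {1} isClosed_singleton
    rw [Set.image_singleton, ofGL_one] at this
    rwa [Subgroup.coe_bot]
  have hstart : Nonempty (Good 0) := by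
    obtain ⟨M, -, hM⟩ := step 0 ⊥ hbot (by rw [Subgroup.coe_bot]; simpa using h1) bot_le
    exact ⟨⟨M, hM⟩⟩
  have hnext : ∀ n (L : Good n), ∃ M : Good (n + 1), L.1 ≤ M.1 := by
    intro n L
    obtain ⟨M, hLM, hM⟩ := step (n + 1) L.1 L.2.1 L.2.2.1 (L.2.2.2.1.trans (hmono n))
    exact ⟨⟨M, hM⟩, hLM⟩
  choose next hnext using hnext
  let L : ∀ n, Good n := fun n => Nat.rec hstart.some next n
  have hL : Monotone fun n => (L n).1 := monotone_nat_of_le_succ fun n => hnext n (L n)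
  refine ⟨⨆ n, (L n).1, ?_, ?_⟩
  · refine isOpen_iff.2 fun T => ?_
    obtain ⟨n, hn⟩ := hcof T
    have hopen : IsOpen (((⨆ n, (L n).1).comap (ofGLHom (S n)) :
        Subgroup (GLPlus Λ F (S n))) : Set (GLPlus Λ F (S n))) :=
      Subgroup.isOpen_mono (Subgroup.comap_mono (le_iSup (fun n => (L n).1) n)) (L n).2.2.2.2
    exact hopen.preimage (GLPlus.continuous_incl hn)
  · rw [Subgroup.coe_iSup_of_directed hL.directed_le]
    exact Set.iUnion_subset fun n => (L n).2.2.1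

instance : NonarchimedeanGroup (AlmostGL Λ F) :=
  nonarchimedeanGroup_of_exists_subgroup continuous_mul_left continuous_mul_right continuous_inv
    fun _ hU h1 => exists_subgroup_isOpen hU h1

instance : T2Space (AlmostGL Λ F) := by
  rw [IsTopologicalGroup.t2Space_iff_one_closed]
  have := isClosedMap_ofGL (F := F) (∅ : Finset Λ) {1} isClosed_singleton
  rwa [Set.image_singleton, ofGL_one] at this

end

end AlmostGL

theorem QuotientGroup.nonarchimedeanGroup {G : Type*} [Group G] [TopologicalSpace G]
    [NonarchimedeanGroup G] (N : Subgroup G) [N.Normal] : NonarchimedeanGroup (G ⧸ N) where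
  is_nonarchimedean U hU := by
    have hU' : (QuotientGroup.mk : G → G ⧸ N) ⁻¹' U ∈ 𝓝 (1 : G) :=
      (QuotientGroup.continuous_mk.tendsto 1) hU
    obtain ⟨V, hV⟩ := NonarchimedeanGroup.is_nonarchimedean _ hU'
    refine ⟨⟨V.toSubgroup.map (QuotientGroup.mk' N), QuotientGroup.isOpenMap_coe _ V.isOpen⟩, ?_⟩
    rintro _ ⟨v, hv, rfl⟩
    exact hV hv

namespace AlmostPGL

/-- The homomorphism from `GL_{Λ+S}(F)` to `aPGL_Λ(F)`. -/
noncomputable def ofGLHom (S : Finset Λ) : GLPlus Λ F S →* AlmostPGL Λ F :=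
  (QuotientGroup.mk' _).comp (AlmostGL.ofGLHom S)

theorem continuous_ofGLHom (S : Finset Λ) :
    Continuous (ofGLHom S : GLPlus Λ F S →* AlmostPGL Λ F) :=
  QuotientGroup.continuous_mk.comp (AlmostGL.continuous_ofGL S)

theorem isClosed_iff {C : Set (AlmostPGL Λ F)} :
    IsClosed C ↔ ∀ S : Finset Λ, IsClosed ((ofGLHom S : GLPlus Λ F S →* AlmostPGL Λ F) ⁻¹' C) := by
  have h : IsClosed ((QuotientGroup.mk : AlmostGL Λ F → AlmostPGL Λ F) ⁻¹' C) ↔ IsClosed C :=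
    isQuotientMap_quot_mk.isClosed_preimage
  exact h.symm.trans AlmostGL.isClosed_iff

omit [TopologicalSpace F] [Finite F] [DiscreteTopology F] in
theorem range_ofGLHom_mono {S T : Finset Λ} (h : S ⊆ T) :
    (ofGLHom S : GLPlus Λ F S →* AlmostPGL Λ F).range ≤ (ofGLHom T).range := by
  rintro _ ⟨u, rfl⟩
  exact ⟨GLPlus.incl h u, rfl⟩

theorem isCompact_range_ofGLHom (S : Finset Λ) :
    IsCompact ((ofGLHom S : GLPlus Λ F S →* AlmostPGL Λ F).range : Set (AlmostPGL Λ F)) := by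
  rw [MonoidHom.coe_range]
  exact isCompact_range (continuous_ofGLHom S)

section

variable [Countable Λ]

instance : IsClosed (Subgroup.center (AlmostGL Λ F) : Set (AlmostGL Λ F)) := by
  rw [Subgroup.coe_center, ← Set.centralizer_univ]
  exact Set.isClosed_centralizer Set.univ

instance : NonarchimedeanGroup (AlmostPGL Λ F) := QuotientGroup.nonarchimedeanGroup _

theorem isProfiniteGroup_range_ofGLHom (S : Finset Λ) :
    IsProfiniteGroup (ofGLHom S : GLPlus Λ F S →* AlmostPGL Λ F).range where
  isTopologicalGroup := inferInstance
  compactSpace := isCompact_iff_compactSpace.1 (isCompact_range_ofGLHom S)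
  t2Space := inferInstance
  totallyDisconnectedSpace := inferInstance

theorem secondCountableTopology_range_ofGLHom (S : Finset Λ) :
    SecondCountableTopology (ofGLHom S : GLPlus Λ F S →* AlmostPGL Λ F).range := by
  have := GLPlus.secondCountableTopology (F := F) S
  have hc : Continuous (ofGLHom S : GLPlus Λ F S →* AlmostPGL Λ F).rangeRestrict :=
    (continuous_ofGLHom S).subtype_mk _
  have hq := hc.isClosedMap.isQuotientMap hc (MonoidHom.rangeRestrict_surjective _)
  exact hq.secondCountableTopology
    (MonoidHom.isOpenQuotientMap_of_isQuotientMap hq).isOpenMap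

/-- A compact set lies in one member of the exhaustion: otherwise choose `x n` in the compact set
outside of the `n`-th member. The tails of this sequence are closed, since they meet each member in
a finite set, so they have a common point by compactness, which is absurd. -/
theorem exists_subset_range_ofGLHom {S : ℕ → Finset Λ} (hS : Monotone S)
    (hcof : ∀ T : Finset Λ, ∃ n, T ⊆ S n) {K : Set (AlmostPGL Λ F)} (hK : IsCompact K) :
    ∃ n, K ⊆ (ofGLHom (S n) : GLPlus Λ F (S n) →* AlmostPGL Λ F).range := by
  by_contra! h
  choose x hxK hx using fun n => Set.not_subset.1 (h n)
  have hfin : ∀ n, ({y | ∃ k ≥ n, x k = y} : Set (AlmostPGL Λ F)) ⊆ K := by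
    rintro n _ ⟨k, -, rfl⟩
    exact hxK k
  have hclosed : ∀ n, IsClosed {y : AlmostPGL Λ F | ∃ k ≥ n, x k = y} := by
    intro n
    refine isClosed_iff.2 fun T => ?_
    obtain ⟨m, hm⟩ := hcof T
    have e : (ofGLHom T : GLPlus Λ F T →* AlmostPGL Λ F) ⁻¹' {y | ∃ k ≥ n, x k = y} =
        (ofGLHom T : GLPlus Λ F T →* AlmostPGL Λ F) ⁻¹' (x '' Set.Ico n m) := by
      ext u
      constructor
      · rintro ⟨k, hk, e⟩
        refine ⟨k, ⟨hk, ?_⟩, e⟩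
        by_contra! hmk
        exact hx k (range_ofGLHom_mono (hm.trans (hS hmk)) ⟨u, e.symm⟩)
      · rintro ⟨k, hk, e⟩
        exact ⟨k, hk.1, e⟩
    rw [e]
    exact ((Set.finite_Ico n m).image x).isClosed.preimage (continuous_ofGLHom T)
  obtain ⟨y, hy⟩ := IsCompact.nonempty_iInter_of_sequence_nonempty_isCompact_isClosed
    (fun n => {y : AlmostPGL Λ F | ∃ k ≥ n, x k = y})
    (fun n y ⟨k, hk, e⟩ => ⟨k, (Nat.le_succ n).trans hk, e⟩) (fun n => ⟨x n, n, le_rfl, rfl⟩)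
    (hK.of_isClosed_subset (hclosed 0) (hfin 0)) hclosed
  rw [Set.mem_iInter] at hy
  obtain ⟨A, rfl⟩ := QuotientGroup.mk_surjective y
  obtain ⟨T, u, rfl⟩ := AlmostGL.exists_ofGL A
  obtain ⟨m, hm⟩ := hcof T
  obtain ⟨k, hk, e⟩ := hy m
  exact hx k (range_ofGLHom_mono (hm.trans (hS hk)) ⟨u, e.symm⟩)

end

end AlmostPGL

end Countable

theorem mainTheorem2 {F : Type*} [Field F] [Finite F] [TopologicalSpace F] [DiscreteTopology F]
    {Λ : Type*} [Preorder Λ] [LocallyFiniteOrder Λ] [Infinite Λ] (hΛ : IsIrreducibleProset Λ) :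
    IsTopologicallySimple (AlmostPGL Λ F) ∧
    (Countable Λ →
      IsTopologicalGroup (AlmostPGL Λ F) ∧ T2Space (AlmostPGL Λ F) ∧
      TotallyDisconnectedSpace (AlmostPGL Λ F) ∧
      IsLocallyElliptic (AlmostPGL Λ F) ∧
      ∃ H : ℕ → Subgroup (AlmostPGL Λ F), Monotone H ∧
        (∀ n, IsProfiniteGroup (H n) ∧ SecondCountableTopology (H n)) ∧
        (⋃ n, (H n : Set (AlmostPGL Λ F))) = Set.univ) := by
  refine ⟨isTopologicallySimple_almostPGL, fun _ => ?_⟩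
  obtain ⟨S, hS, hcof⟩ := exists_monotone_exhaustion Λ
  refine ⟨inferInstance, inferInstance, inferInstance, fun K hK => ?_,
    fun n => (AlmostPGL.ofGLHom (S n)).range,
    fun m n hmn => AlmostPGL.range_ofGLHom_mono (hS hmn),
    fun n => ⟨AlmostPGL.isProfiniteGroup_range_ofGLHom _,
      AlmostPGL.secondCountableTopology_range_ofGLHom _⟩, ?_⟩
  · obtain ⟨n, hn⟩ := AlmostPGL.exists_subset_range_ofGLHom hS hcof hK
    exact ⟨_, hn, AlmostPGL.isCompact_range_ofGLHom _⟩
  · refine Set.eq_univ_of_forall fun y => ?_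
    obtain ⟨A, rfl⟩ := QuotientGroup.mk_surjective y
    obtain ⟨T, u, rfl⟩ := AlmostGL.exists_ofGL A
    obtain ⟨n, hn⟩ := hcof T
    exact Set.mem_iUnion.2 ⟨n, AlmostPGL.range_ofGLHom_mono hn ⟨u, rfl⟩⟩
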